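/- Let $\mathcal H$ be a separable real Hilbert space with its Borel $\sigma$-algebra, let $(E,\mathcal E,\mu)$ be a complete probability space, and let $A:E\times\mathcal H\to 2^{\mathcal H}$ be such that $A(s,\cdot)$ is maximal monotone for $\mu$-a.e. $s$ and such that, for all $\lambda>0$ and $x\in\mathcal H$, the resolvent $s\mapsto J_\lambda(s,x)=(I+\lambda A(s,\cdot))^{-1}(x)$ is measurable. Put $D_s=\{x: A(s,x)\neq\emptyset\}$, let $\mathcal D$ be the set of all $x\in\mathcal H$ with $x\in D_s$ for $\mu$-a.e. $s$, and for $x\in D_s$ let $A_0(s,x)$ be the element of least norm of $A(s,x)$. Let $$\underline A(x)=\int A(s,x)\,d\mu(s)=\Big\{\int\phi\,d\mu \;:\; \phi\in L^1(E,\mathcal H,\mu)\text{ measurable, } \phi(s)\in A(s,x)\ \text{for } \mu\text{-a.e. } s\Big\}$$ (the Aumann integral) and $\mathrm{zer}(\underline A)=\{x: 0\in\underline A(x)\}$. Assume: 1. $(\lambda_n)_{n\ge 0}$ is a sequence of positive reals with $\sum_n\lambda_n=\infty$ and $\sum_n\lambda_n^2<\infty$, and $(\xi_n)_{n\geq 1}$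 is a sequence of independent $E$-valued random variables with distribution $\mu$ on a probability space $(\Omega,\mathcal F,\mathbb P)$; 2. $\underline A$ is maximal monotone; 3. $\mathrm{zer}(\underline A)\neq\emptyset$, and for every $x\in\mathrm{zer}(\underline A)$ there is a measurable $\phi\in L^2(E,\mathcal H,\mu)$ with $\phi(s)\in A(s,x)$ for $\mu$-a.e. $s$ and $\int\phi\,d\mu=0$; 4. for every bounded set $K\subset\mathcal H$ the family $(\|A_0(\cdot,x)\| : x\in K\cap\mathcal D)$ is uniformly integrable with respect to $\mu$; 5. the domains $D_s$ coincide for all $s$ outside a $\mu$-negligible set. Let $x_0\in\mathcal H$ be fixed, $x_{n+1}=J_{\lambda_n}(\xi_{n+1},x_n)$ for $n\ge 0$, and $\overline x_n=\sum_{k=1}^n\lambda_k x_k\big/\sum_{k=1}^n\lambda_k$ for $n\geq 1$. Then, almost surely, $(\overline x_n)$ converges weakly to a zero of $\underline A$ (which may depend on the realization). -/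

import Mathlib

open MeasureTheory ProbabilityTheory Filter Topology

namespace StochProx

section Operators

variable {H : Type*} [NormedAddCommGroup H] [InnerProductSpace ℝ H]

/-- A set-valued operator `T : H → 2^H` is monotone if `⟪y - y', x - x'⟫ ≥ 0` for all
`(x, y)`, `(x', y')` in its graph. -/
def IsMonotoneOp (T : H → Set H) : Prop :=
  ∀ x x' y y' : H, y ∈ T x → y' ∈ T x' → 0 ≤ inner ℝ (y - y') (x - x')

/-- `T` is maximal monotone if it is monotone and no other monotone operator has a graph that
contains the graph of `T`. -/
def IsMaximalMonotoneOp (T : H → Set H) : Prop :=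
  IsMonotoneOp T ∧
    ∀ T' : H → Set H, IsMonotoneOp T' → (∀ x, T x ⊆ T' x) → T = T'

/-- The domain of a set-valued operator: the points at which its value is non-empty. -/
def opDomain (T : H → Set H) : Set H := {x | (T x).Nonempty}

/-- The set of zeroes of a set-valued operator. -/
def opZeros (T : H → Set H) : Set H := {x | (0 : H) ∈ T x}

/-- The set-valued resolvent `(I + r T)⁻¹`: `y ∈ (I + r T)⁻¹ x` iff `x ∈ y + r T y`. -/
def resolventSet (T : H → Set H) (r : ℝ) (x : H) : Set H :=
  {y | ∃ v ∈ T y, x = y + r • v}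

open Classical in
/-- The resolvent `J_r = (I + r T)⁻¹` as a point-valued map: an element of `(I + r T)⁻¹ x`.
If `T` is maximal monotone and `r > 0`, then `(I + r T)⁻¹ x` has exactly one element; the value
`0` is used where that set is empty. -/
noncomputable def resolventMap (T : H → Set H) (r : ℝ) (x : H) : H :=
  if h : (resolventSet T r x).Nonempty then h.some else 0

open Classical in
/-- The element of least norm of `C`, that is the projection of `0` on `C`. It exists and is
unique when `C` is non-empty, closed and convex; the value `0` is used where there is none. -/
noncomputable def leastNorm (C : Set H) : H :=
  if h : ∃ y ∈ C, ∀ z ∈ C, ‖y‖ ≤ ‖z‖ then h.choose else 0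

/-- The weighted averages `(∑_{k=1}^n r_k a_k) / (∑_{k=1}^n r_k)`. -/
noncomputable def weightedAverage (r : ℕ → ℝ) (a : ℕ → H) (n : ℕ) : H :=
  (∑ k ∈ Finset.Icc 1 n, r k)⁻¹ • ∑ k ∈ Finset.Icc 1 n, r k • a k

end Operators

section RandomOperators

variable {E H Ω : Type*} [MeasurableSpace E] [NormedAddCommGroup H] [InnerProductSpace ℝ H]
  [MeasurableSpace H]

/-- The essential intersection of the domains: the points that belong to the domain of `A s`
for every `s` outside a `μ`-negligible set. -/
def essDomain (μ : Measure E) (A : E → H → Set H) : Set H :=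
  {x | ∀ᵐ s ∂μ, x ∈ opDomain (A s)}

/-- The `p`-integrable measurable selections of `s ↦ A s x`. -/
def selections (μ : Measure E) (A : E → H → Set H) (p : ENNReal) (x : H) : Set (E → H) :=
  {φ | Measurable φ ∧ (∀ᵐ s ∂μ, φ s ∈ A s x) ∧ MemLp φ p μ}

/-- The mean operator `x ↦ ∫ A(s, x) dμ(s)`, where the integral is the Aumann integral: the set
of the Bochner integrals of all integrable measurable selections. -/
noncomputable def meanOp (μ : Measure E) (A : E → H → Set H) (x : H) : Set H :=
  {v | ∃ φ ∈ selections μ A 1 x, ∫ s, φ s ∂μ = v}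

/-- The points `x` for which `s ↦ A s x` has a `p`-integrable selection with zero integral. -/
def pZeros (μ : Measure E) (A : E → H → Set H) (p : ENNReal) : Set H :=
  {x | ∃ φ ∈ selections μ A p x, ∫ s, φ s ∂μ = 0}

/-- The stochastic proximal point algorithm `x_{n+1} = J_{r_n}(ξ_{n+1}, x_n)` started at `x₀`. -/
noncomputable def proxIter (A : E → H → Set H) (r : ℕ → ℝ) (ξ : ℕ+ → Ω → E) (x₀ : H) :
    ℕ → Ω → H
  | 0, _ => x₀
  | n + 1, ω => resolventMap (A (ξ n.succPNat ω)) (r n) (proxIter A r ξ x₀ n ω)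

end RandomOperators

end StochProx

open StochProx

/-! The proof combines a Fejér estimate in mean with an Opial-type argument for averages. Let `z` be
a zero of the mean operator and `φ ∈ L²` a selection at `z` with zero integral. Monotonicity gives
`‖x_{n+1} - z‖² ≤ ‖x_n - z‖² - ‖x_{n+1} - x_n‖²/2 - 2 r_n ⟪φ(ξ_{n+1}), x_n - z⟫ + 2 r_n²
‖φ(ξ_{n+1})‖²`. The inner product has conditional mean zero and the last term is summable. Hence
`‖x_n - z‖` converges almost surely, and the squared increments have summable expectations
(`summable_integral_increments_and_ae_tendsto`).

For a fixed `u`, expanding `‖x_{n+1} - u‖²` and telescoping bounds the sums of `⟪x_n - x_{n+1}, x_n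
- u⟫` from above. They differ from the sums of their conditional expectations, which are integrals
over `μ`, by an `L²`-bounded martingale (`ae_exists_sum_integral_inner_le`). Uniform integrability
shows that for small `r` such an integral is at least `r (⟪v, x - u⟫ - ε)` for `v` in the mean
operator at `u`, uniformly over bounded sets of `x` in the common domain
(`exists_forall_inner_le_integral_inner_sub_resolventMap`).

Dividing by `∑ r_k → ∞`, every weak cluster point `a` of the averages satisfies `⟪v, a - u⟫ ≤ 0` on
the graph, so it is a zero by maximality. Two cluster points coincide because `⟪z - z', x_n⟫`
converges for all zeroes `z`, `z'` (`exists_tendsto_toWeakSpace_weightedAverage`). -/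

namespace StochProx

/-! ### Minty's theorem through the Fitzpatrick function. -/

section Minty

variable {V : Type*} [NormedAddCommGroup V] [InnerProductSpace ℝ V] [CompleteSpace V]

/-- A supremum of quadratic functions with identity Hessian, finite somewhere and bounded below,
attains its minimum, and grows quadratically away from it. -/
theorem exists_minimizer_iSup_quadratic {ι : Type*} (w : ι → V) (c : ι → ℝ) {b₀ t₀ : ℝ} {q₀ : V}
    (h₀ : ∀ i, ‖q₀‖ ^ 2 / 2 + inner ℝ q₀ (w i) - c i ≤ t₀)
    (hb : ∀ q t, (∀ i, ‖q‖ ^ 2 / 2 + inner ℝ q (w i) - c i ≤ t) → b₀ ≤ t) :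
    ∃ p, ∀ q t, (∀ i, ‖q‖ ^ 2 / 2 + inner ℝ q (w i) - c i ≤ t) →
      ∀ i, ‖p‖ ^ 2 / 2 + inner ℝ p (w i) - c i + ‖q - p‖ ^ 2 / 2 ≤ t := by
  set f : ι → V → ℝ := fun i q => ‖q‖ ^ 2 / 2 + inner ℝ q (w i) - c i with hf
  have hconv : ∀ i (p q : V) (θ : ℝ),
      f i (p + θ • (q - p)) = (1 - θ) * f i p + θ * f i q - θ * (1 - θ) / 2 * ‖q - p‖ ^ 2 := by
    intro i p q θ
    simp only [hf, ← real_inner_self_eq_norm_sq, inner_add_left, inner_add_right, inner_smul_left,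
      inner_smul_right, inner_sub_left, inner_sub_right, real_inner_comm p q,
      RCLike.conj_to_real]
    ring
  -- The supremum may be infinite, so it enters only through its real upper bounds `t`.
  set T : Set ℝ := {t | ∃ q, ∀ i, f i q ≤ t} with hT
  have hTne : T.Nonempty := ⟨t₀, q₀, h₀⟩
  have hTb : BddBelow T := ⟨b₀, by rintro t ⟨q, hq⟩; exact hb q t hq⟩
  set m := sInf T
  have hm : ∀ q t, (∀ i, f i q ≤ t) → m ≤ t := fun q t h => csInf_le hTb ⟨q, h⟩
  have hex : ∀ n : ℕ, ∃ q, ∀ i, f i q ≤ m + 1 / ((n : ℝ) + 1) := by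
    intro n
    obtain ⟨t, ⟨q, hq⟩, ht⟩ := exists_lt_of_csInf_lt hTne
      (lt_add_of_pos_right m (by positivity : 0 < 1 / ((n : ℝ) + 1)))
    exact ⟨q, fun i => (hq i).trans ht.le⟩
  choose q hq using hex
  have hdist : ∀ ε, 0 < ε → ∀ a b, (∀ i, f i a ≤ m + ε) → (∀ i, f i b ≤ m + ε) →
      ‖b - a‖ ^ 2 ≤ 8 * ε := by
    intro ε hε a b ha hb
    have := hm (a + (1 / 2 : ℝ) • (b - a)) (m + ε - 1 / 8 * ‖b - a‖ ^ 2) (by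
      intro i; rw [hconv]; linarith [ha i, hb i])
    linarith
  have hcau : CauchySeq q := by
    rw [Metric.cauchySeq_iff']
    intro ε hε
    obtain ⟨N, hN⟩ := exists_nat_one_div_lt (by positivity : 0 < ε ^ 2 / 8)
    refine ⟨N, fun n hn => ?_⟩
    have h1 := hdist (1 / ((N : ℝ) + 1)) (by positivity) (q N) (q n) (hq N)
      (fun i => (hq n i).trans (by gcongr))
    rw [dist_eq_norm]
    exact lt_of_pow_lt_pow_left₀ 2 hε.le (by linarith)
  obtain ⟨p, hp⟩ := cauchySeq_tendsto_of_complete hcau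
  have hpm : ∀ i, f i p ≤ m := by
    intro i
    have h1 : Tendsto (fun n => f i (q n)) atTop (𝓝 (f i p)) := by
      have : Continuous (f i) := by fun_prop
      exact (this.tendsto p).comp hp
    have h2 : Tendsto (fun n : ℕ => m + 1 / ((n : ℝ) + 1)) atTop (𝓝 (m + 0)) :=
      tendsto_const_nhds.add tendsto_one_div_add_atTop_nhds_zero_nat
    rw [add_zero] at h2
    exact le_of_tendsto_of_tendsto' h1 h2 (fun n => hq n i)
  refine ⟨p, fun q t hqt i => ?_⟩
  -- Minimality at `p + θ (q - p)`, divided by `θ`; the growth bound follows as `θ → 0`.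
  have key : ∀ θ ∈ Set.Ioo (0 : ℝ) 1, m + (1 - θ) / 2 * ‖q - p‖ ^ 2 ≤ t := by
    rintro θ ⟨h0, h1⟩
    have := hm (p + θ • (q - p)) ((1 - θ) * m + θ * t - θ * (1 - θ) / 2 * ‖q - p‖ ^ 2) (by
      intro i; rw [hconv]
      have := mul_le_mul_of_nonneg_left (hpm i) (sub_pos.2 h1).le
      have := mul_le_mul_of_nonneg_left (hqt i) h0.le
      simp only [hf] at *
      linarith)
    have h2 : 0 ≤ θ * (t - m - (1 - θ) / 2 * ‖q - p‖ ^ 2) := by linarith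
    linarith [nonneg_of_mul_nonneg_right h2 h0]
  have hlim : Tendsto (fun θ : ℝ => m + (1 - θ) / 2 * ‖q - p‖ ^ 2) (𝓝[>] 0)
      (𝓝 (m + (1 - 0) / 2 * ‖q - p‖ ^ 2)) :=
    ((by fun_prop : Continuous fun θ : ℝ => m + (1 - θ) / 2 * ‖q - p‖ ^ 2).tendsto 0).mono_left
      nhdsWithin_le_nhds
  have := le_of_tendsto hlim (by
    filter_upwards [Ioo_mem_nhdsGT (zero_lt_one' ℝ)] with θ hθ using key θ hθ)
  have := hpm i
  simp only [hf] at *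
  linarith

/-- **Minty's theorem** for graphs: a maximal monotone subset of `V × V` meets the antidiagonal. -/
theorem exists_neg_mem_of_maximal_monotone (G : Set (V × V))
    (hmono : ∀ g ∈ G, ∀ g' ∈ G, 0 ≤ inner ℝ (g.2 - g'.2) (g.1 - g'.1))
    (hmax : ∀ a b, (∀ g ∈ G, 0 ≤ inner ℝ (b - g.2) (a - g.1)) → (a, b) ∈ G) :
    ∃ a, (a, -a) ∈ G := by
  have hne : G.Nonempty := by
    by_contra h
    rw [Set.not_nonempty_iff_eq_empty] at h
    have := hmax 0 0 (by simp [h])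
    simp [h] at this
  obtain ⟨g₀, hg₀⟩ := hne
  -- With these `w` and `c`, the supremum is the Fitzpatrick function of `G` plus half the squared
  -- norm. It equals `‖g.1 + g.2‖² / 2` on `G`, and by maximality is at least `‖q.fst + q.snd‖² / 2`
  -- everywhere.
  let w : G → WithLp 2 (V × V) := fun g => WithLp.toLp 2 (g.1.2, g.1.1)
  let c : G → ℝ := fun g => inner ℝ g.1.1 g.1.2
  have hval : ∀ (q : WithLp 2 (V × V)) (g : G), ‖q‖ ^ 2 / 2 + inner ℝ q (w g) - c g =
      (‖q.fst‖ ^ 2 + ‖q.snd‖ ^ 2) / 2 + inner ℝ q.fst g.1.2 + inner ℝ q.snd g.1.1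
        - inner ℝ g.1.1 g.1.2 := by
    intro q g
    rw [WithLp.prod_norm_sq_eq_of_L2, WithLp.prod_inner_apply]
    simp [w, c]
    ring
  have hgraph : ∀ g ∈ G, ∀ i : G, ‖WithLp.toLp 2 g‖ ^ 2 / 2 + inner ℝ (WithLp.toLp 2 g) (w i) - c i
      ≤ (‖g.1‖ ^ 2 + ‖g.2‖ ^ 2) / 2 + inner ℝ g.1 g.2 := by
    intro g hg i
    rw [hval]
    have := hmono g hg i.1 i.2
    simp only [inner_sub_left, inner_sub_right] at this
    simp only [real_inner_comm g.1 g.2] at this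
    simp only [WithLp.toLp_fst, WithLp.toLp_snd]
    linarith [real_inner_comm i.1.1 g.2, real_inner_comm i.1.1 i.1.2, real_inner_comm i.1.2 g.1]
  have hlow : ∀ (q : WithLp 2 (V × V)) (t : ℝ), (∀ i, ‖q‖ ^ 2 / 2 + inner ℝ q (w i) - c i ≤ t) →
      (‖q.fst‖ ^ 2 + ‖q.snd‖ ^ 2) / 2 + inner ℝ q.fst q.snd ≤ t := by
    intro q t h
    by_contra hlt
    push Not at hlt
    have hin : (q.fst, q.snd) ∈ G := by
      refine hmax _ _ fun g hg => ?_
      have := h ⟨g, hg⟩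
      rw [hval] at this
      simp only [inner_sub_left, inner_sub_right]
      linarith [real_inner_comm q.fst q.snd, real_inner_comm q.fst g.2, real_inner_comm g.1 g.2]
    have := h ⟨_, hin⟩
    rw [hval] at this
    linarith [real_inner_comm q.fst q.snd]
  obtain ⟨p, hp⟩ := exists_minimizer_iSup_quadratic w c (b₀ := 0) (hgraph g₀ hg₀) (fun q t h => by
    have h1 := hlow q t h
    have h2 := norm_add_sq_real q.fst q.snd
    nlinarith [sq_nonneg ‖q.fst + q.snd‖])
  -- Quadratic growth from the minimizer `p` to a point of `G` makes `(-p.snd, -p.fst)`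
  -- monotonically related to `G`, hence a member; taking it for `g` forces `p.fst + p.snd = 0`.
  have hrel : ∀ g ∈ G, ‖p.fst + p.snd‖ ^ 2 ≤ inner ℝ (-p.fst - g.2) (-p.snd - g.1) := by
    intro g hg
    have h1 := hp _ _ (hgraph g hg)
    have h2 := hlow p ((‖g.1‖ ^ 2 + ‖g.2‖ ^ 2) / 2 + inner ℝ g.1 g.2
      - ‖WithLp.toLp 2 g - p‖ ^ 2 / 2) (fun i => by linarith [h1 i])
    rw [WithLp.prod_norm_sq_eq_of_L2] at h2
    simp only [WithLp.sub_fst, WithLp.sub_snd, WithLp.toLp_fst, WithLp.toLp_snd,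
      norm_sub_sq_real] at h2
    rw [norm_add_sq_real]
    simp only [inner_sub_left, inner_sub_right, inner_neg_left, inner_neg_right]
    linarith [real_inner_comm p.fst p.snd, real_inner_comm p.fst g.1, real_inner_comm g.1 g.2,
      real_inner_comm p.snd g.2]
  have hin := hmax (-p.snd) (-p.fst) (fun g hg => (sq_nonneg _).trans (hrel g hg))
  have h0 := hrel _ hin
  simp only [sub_self, inner_zero_left] at h0
  have h1 : p.fst + p.snd = 0 := by
    rw [← norm_eq_zero]; exact pow_eq_zero_iff (two_ne_zero) |>.1 (le_antisymm h0 (sq_nonneg _))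
  refine ⟨-p.snd, ?_⟩
  rwa [eq_neg_of_add_eq_zero_left h1] at hin

end Minty

/-! ### Maximal monotone operators and their resolvents. -/

section Operators

variable {H : Type*} [NormedAddCommGroup H] [InnerProductSpace ℝ H]

/-- Adjoining the pair `(a, b)` keeps the graph monotone, so by maximality it was already there. -/
theorem IsMaximalMonotoneOp.mem_of_forall {T : H → Set H} (hT : IsMaximalMonotoneOp T) {a b : H}
    (h : ∀ u, ∀ v ∈ T u, 0 ≤ inner ℝ (b - v) (a - u)) : b ∈ T a := by
  have := hT.2 (fun x => T x ∪ {y | x = a ∧ y = b}) ?_ (fun x => Set.subset_union_left)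
  · rw [this]; exact Or.inr ⟨rfl, rfl⟩
  · rintro x x' y y' (hy | ⟨rfl, rfl⟩) (hy' | ⟨rfl, rfl⟩)
    · exact hT.1 _ _ _ _ hy hy'
    · rw [← inner_neg_neg, neg_sub, neg_sub]; exact h _ _ hy
    · exact h _ _ hy'
    · simp

theorem IsMaximalMonotoneOp.isClosed {T : H → Set H} (hT : IsMaximalMonotoneOp T) (x : H) :
    IsClosed (T x) := by
  have : T x = ⋂ u, ⋂ v ∈ T u, {b | 0 ≤ inner ℝ (b - v) (x - u)} := by
    ext b
    simp only [Set.mem_iInter, Set.mem_ofPred_eq]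
    exact ⟨fun hb u v hv => hT.1 _ _ _ _ hb hv, hT.mem_of_forall⟩
  rw [this]
  exact isClosed_iInter fun u => isClosed_iInter fun v => isClosed_iInter fun _ =>
    isClosed_le continuous_const (by fun_prop)

theorem IsMaximalMonotoneOp.convex {T : H → Set H} (hT : IsMaximalMonotoneOp T) (x : H) :
    Convex ℝ (T x) := by
  intro b hb b' hb' s t hs ht hst
  refine hT.mem_of_forall fun u v hv => ?_
  have h : s • b + t • b' - v = s • (b - v) + t • (b' - v) := by
    have : v = (s + t) • v := by rw [hst, one_smul]
    conv_lhs => rw [this]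
    module
  rw [h, inner_add_left, inner_smul_left, inner_smul_left]
  have h1 := hT.1 _ _ _ _ hb hv
  have h2 := hT.1 _ _ _ _ hb' hv
  simp only [RCLike.conj_to_real]
  positivity

variable [CompleteSpace H]

theorem IsMaximalMonotoneOp.leastNorm_mem {T : H → Set H} (hT : IsMaximalMonotoneOp T) {x : H}
    (hx : x ∈ opDomain T) : leastNorm (T x) ∈ T x := by
  have hex : ∃ y ∈ T x, ∀ z ∈ T x, ‖y‖ ≤ ‖z‖ := by
    obtain ⟨y, hy, hy'⟩ := exists_norm_eq_iInf_of_complete_convex hx (hT.isClosed x).isComplete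
      (hT.convex x) 0
    refine ⟨y, hy, fun z hz => ?_⟩
    simp only [zero_sub, norm_neg] at hy'
    rw [hy']
    exact ciInf_le (f := fun w : T x => ‖(w : H)‖)
      ⟨0, by rintro _ ⟨w, rfl⟩; exact norm_nonneg _⟩ ⟨z, hz⟩
  rw [leastNorm, dif_pos hex]
  exact hex.choose_spec.1

/-- **Minty's theorem**: the resolvents of a maximal monotone operator are everywhere defined. -/
theorem IsMaximalMonotoneOp.resolventSet_nonempty {T : H → Set H} (hT : IsMaximalMonotoneOp T)
    {r : ℝ} (hr : 0 < r) (x : H) : (resolventSet T r x).Nonempty := by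
  -- The graph of `r T - x`: a point `(a, -a)` on it solves `x = a + r v` with `v ∈ T a`.
  set G := {g : H × H | ∃ v ∈ T g.1, g.2 = r • v - x} with hG
  have hmono : ∀ g ∈ G, ∀ g' ∈ G, 0 ≤ inner ℝ (g.2 - g'.2) (g.1 - g'.1) := by
    rintro ⟨a, b⟩ ⟨v, hv, hb⟩ ⟨a', b'⟩ ⟨v', hv', hb'⟩
    simp only at hv hv' hb hb' ⊢
    rw [hb, hb', sub_sub_sub_cancel_right, ← smul_sub, inner_smul_left]
    exact mul_nonneg hr.le (hT.1 _ _ _ _ hv hv')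
  have hmax : ∀ a b, (∀ g ∈ G, 0 ≤ inner ℝ (b - g.2) (a - g.1)) → (a, b) ∈ G := by
    intro a b h
    refine ⟨r⁻¹ • (b + x), hT.mem_of_forall fun u v hv => ?_, ?_⟩
    · have := h (u, r • v - x) ⟨v, hv, rfl⟩
      have h2 : r⁻¹ • (b + x) - v = r⁻¹ • (b - (r • v - x)) := by
        rw [smul_sub, smul_sub, smul_smul, inv_mul_cancel₀ hr.ne', one_smul, smul_add]; abel
      rw [h2, inner_smul_left]
      exact mul_nonneg (inv_nonneg.2 hr.le) this
    · simp only
      rw [smul_smul, mul_inv_cancel₀ hr.ne', one_smul]; abel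
  obtain ⟨a, v, hv, hva⟩ := exists_neg_mem_of_maximal_monotone G hmono hmax
  refine ⟨a, v, hv, ?_⟩
  simp only at hva
  rw [show r • v = -a + x by rw [hva]; abel]; abel

/-- The Yosida approximation at `x` is a value of `T` at the resolvent of `x`. -/
theorem IsMaximalMonotoneOp.exists_resolventMap {T : H → Set H} (hT : IsMaximalMonotoneOp T)
    {r : ℝ} (hr : 0 < r) (x : H) :
    ∃ v ∈ T (resolventMap T r x), x - resolventMap T r x = r • v := by
  have h := hT.resolventSet_nonempty hr x
  obtain ⟨v, hv, hx⟩ := h.some_mem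
  rw [resolventMap, dif_pos h]
  exact ⟨v, hv, by rw [sub_eq_iff_eq_add']; exact hx⟩

theorem IsMaximalMonotoneOp.resolventMap_mem {T : H → Set H} (hT : IsMaximalMonotoneOp T)
    {r : ℝ} (hr : 0 < r) (x : H) : resolventMap T r x ∈ opDomain T :=
  let ⟨v, hv, _⟩ := hT.exists_resolventMap hr x
  ⟨v, hv⟩

theorem IsMaximalMonotoneOp.inner_resolventMap {T : H → Set H} (hT : IsMaximalMonotoneOp T)
    {r : ℝ} (hr : 0 < r) (x : H) {u w : H} (hw : w ∈ T u) :
    r * inner ℝ w (resolventMap T r x - u) ≤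
      inner ℝ (x - resolventMap T r x) (resolventMap T r x - u) := by
  obtain ⟨v, hv, hx⟩ := hT.exists_resolventMap hr x
  have h := hT.1 _ _ _ _ hv hw
  rw [hx, inner_smul_left]
  rw [inner_sub_left] at h
  exact mul_le_mul_of_nonneg_left (by linarith) hr.le

theorem IsMaximalMonotoneOp.norm_resolventMap_sub_le {T : H → Set H} (hT : IsMaximalMonotoneOp T)
    {r : ℝ} (hr : 0 < r) (x y : H) :
    ‖resolventMap T r x - resolventMap T r y‖ ≤ ‖x - y‖ := by
  obtain ⟨v, hv, hx⟩ := hT.exists_resolventMap hr x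
  obtain ⟨w, hw, hy⟩ := hT.exists_resolventMap hr y
  have h := mul_nonneg hr.le (hT.1 _ _ _ _ hv hw)
  have e : x - y = r • (v - w) + (resolventMap T r x - resolventMap T r y) := by
    rw [smul_sub, ← hx, ← hy]; abel
  refine le_of_sq_le_sq ?_ (norm_nonneg _)
  rw [e, norm_add_sq_real, inner_smul_left]
  simp only [RCLike.conj_to_real]
  nlinarith [sq_nonneg ‖r • (v - w)‖]

/-- With `w` the element of least norm, this bounds displacements by the uniformly integrable
family. -/
theorem IsMaximalMonotoneOp.norm_sub_resolventMap_le {T : H → Set H} (hT : IsMaximalMonotoneOp T)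
    {r : ℝ} (hr : 0 < r) {x w : H} (hw : w ∈ T x) :
    ‖x - resolventMap T r x‖ ≤ r * ‖w‖ := by
  have h := hT.inner_resolventMap hr x hw
  have h1 : ‖x - resolventMap T r x‖ ^ 2 ≤ r * ‖w‖ * ‖x - resolventMap T r x‖ := by
    have h2 := real_inner_le_norm w (x - resolventMap T r x)
    rw [← neg_sub x (resolventMap T r x), inner_neg_right, inner_neg_right,
      real_inner_self_eq_norm_sq] at h
    nlinarith
  rcases (norm_nonneg (x - resolventMap T r x)).eq_or_lt with h0 | h0
  · rw [← h0]; positivity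
  · exact le_of_mul_le_mul_right (by rw [← sq]; exact h1) h0

/-- The basic estimate of the proximal point algorithm. -/
theorem IsMaximalMonotoneOp.norm_resolventMap_sub_sq_le {T : H → Set H}
    (hT : IsMaximalMonotoneOp T) {r : ℝ} (hr : 0 < r) (x : H) {z w : H} (hw : w ∈ T z) :
    ‖resolventMap T r x - z‖ ^ 2 ≤ ‖x - z‖ ^ 2 - ‖resolventMap T r x - x‖ ^ 2 / 2
      - 2 * (r * inner ℝ w (x - z)) + 2 * (r ^ 2 * ‖w‖ ^ 2) := by
  have h := hT.inner_resolventMap hr x hw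
  set y := resolventMap T r x
  have e1 : ‖x - z‖ ^ 2 = ‖x - y‖ ^ 2 + 2 * inner ℝ (x - y) (y - z) + ‖y - z‖ ^ 2 := by
    rw [← norm_add_sq_real, sub_add_sub_cancel]
  -- Replacing `y` by `x` lets `w` be tested against a vector known before the step is drawn. The
  -- remainder is absorbed by `2 r ‖w‖ ‖x - y‖ ≤ ‖x - y‖² / 2 + 2 r² ‖w‖²`.
  have e2 : inner ℝ w (y - z) = inner ℝ w (x - z) - inner ℝ w (x - y) := by
    rw [← inner_sub_right]; congr 1; abel
  have h3 := real_inner_le_norm w (x - y)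
  rw [norm_sub_rev y x]
  rw [e2] at h
  have h4 := mul_le_mul_of_nonneg_left h3 hr.le
  nlinarith [sq_nonneg (‖x - y‖ - 2 * (r * ‖w‖))]

end Operators

/-! ### Conditional expectations and square-integrable martingales. -/

section Probability

/-- Conditional expectation of a function of an independent variable and a measurable one. -/
theorem condExp_comp_of_indep {Ω E X : Type*} {m mΩ : MeasurableSpace Ω} [MeasurableSpace E]
    [MeasurableSpace X] {P : Measure Ω} [IsProbabilityMeasure P] {μ : Measure E}
    (hm : m ≤ mΩ) {ξ : Ω → E} (hξ : Measurable ξ) (hlaw : P.map ξ = μ)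
    (hind : Indep m (MeasurableSpace.comap ξ inferInstance) P) {x : Ω → X} (hx : Measurable[m] x)
    {g : E → X → ℝ} (hg : Measurable (Function.uncurry g))
    (hint : Integrable (fun ω => g (ξ ω) (x ω)) P) :
    P[fun ω => g (ξ ω) (x ω) | m] =ᵐ[P] fun ω => ∫ s, g s (x ω) ∂μ := by
  have : IsProbabilityMeasure μ := hlaw ▸ Measure.isProbabilityMeasure_map hξ.aemeasurable
  have hx' : Measurable x := hx.mono hm le_rfl
  have hprod : ∀ {Y : Type _} [MeasurableSpace Y] (y : Ω → Y), Measurable[m] y →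
      P.map (fun ω => (y ω, ξ ω)) = (P.map y).prod μ := by
    intro Y _ y hy
    have hi : IndepFun y ξ P := indep_of_indep_of_le_left hind hy.comap_le
    rw [(indepFun_iff_map_prod_eq_prod_map_map (hy.mono hm le_rfl).aemeasurable
      hξ.aemeasurable).1 hi, hlaw]
  have hgm : StronglyMeasurable fun p : X × E => g p.2 p.1 :=
    (hg.comp measurable_swap).stronglyMeasurable
  have hGm : StronglyMeasurable fun y : X => ∫ s, g s y ∂μ := hgm.integral_prod_right
  have hint1 : Integrable (fun p : X × E => g p.2 p.1) ((P.map x).prod μ) := by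
    rw [← hprod x hx, integrable_map_measure hgm.aestronglyMeasurable (by fun_prop)]
    exact hint
  have hGint : Integrable (fun ω => ∫ s, g s (x ω) ∂μ) P :=
    (integrable_map_measure hGm.aestronglyMeasurable hx'.aemeasurable).1 hint1.integral_prod_left
  refine (ae_eq_condExp_of_forall_setIntegral_eq hm hint (fun _ _ _ => hGint.integrableOn) ?_
    (hGm.comp_measurable hx).aestronglyMeasurable).symm
  intro B hB _
  -- Adjoining the indicator of the test set to `x` keeps `m`-measurability, so the pair is still
  -- independent of `ξ` and Fubini applies.
  have hone : Measurable[m] (B.indicator (fun _ => (1 : ℝ))) := measurable_const.indicator hB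
  have hZ : Measurable[m] (fun ω => (x ω, B.indicator (fun _ => (1 : ℝ)) ω)) := hx.prodMk hone
  have hk : StronglyMeasurable fun p : (X × ℝ) × E => p.1.2 * g p.2 p.1.1 := by
    apply Measurable.stronglyMeasurable
    exact (measurable_snd.comp measurable_fst).mul
      (hg.comp (measurable_snd.prodMk (measurable_fst.comp measurable_fst)))
  have hmul : ∀ f : Ω → ℝ, ∫ ω in B, f ω ∂P = ∫ ω, B.indicator (fun _ => (1 : ℝ)) ω * f ω ∂P := by
    intro f
    rw [← integral_indicator (hm _ hB)]
    congr 1; ext ω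
    by_cases h : ω ∈ B <;> simp [h]
  rw [hmul, hmul]
  have e1 : ∫ ω, B.indicator (fun _ => (1 : ℝ)) ω * g (ξ ω) (x ω) ∂P =
      ∫ p, p.1.2 * g p.2 p.1.1
        ∂((P.map (fun ω => (x ω, B.indicator (fun _ => (1 : ℝ)) ω))).prod μ) := by
    rw [← hprod _ hZ, integral_map ((hZ.mono hm le_rfl).prodMk hξ).aemeasurable
      hk.aestronglyMeasurable]
  have hintk : Integrable (fun p : (X × ℝ) × E => p.1.2 * g p.2 p.1.1)
      ((P.map (fun ω => (x ω, B.indicator (fun _ => (1 : ℝ)) ω))).prod μ) := by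
    rw [← hprod _ hZ, integrable_map_measure hk.aestronglyMeasurable
      ((hZ.mono hm le_rfl).prodMk hξ).aemeasurable]
    refine (hint.indicator (hm _ hB)).congr (ae_of_all _ fun ω => ?_)
    by_cases h : ω ∈ B <;> simp [h]
  rw [e1, integral_prod _ hintk, integral_map (hZ.mono hm le_rfl).aemeasurable
    hk.integral_prod_right.aestronglyMeasurable]
  simp only [integral_const_mul]

/-- Convergence of the centred sums of a square-summable adapted sequence. -/
theorem ae_exists_tendsto_sum_sub_condExp {Ω : Type*} {mΩ : MeasurableSpace Ω} {P : Measure Ω}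
    [IsProbabilityMeasure P] (ℱ : Filtration ℕ mΩ) (Y : ℕ → Ω → ℝ)
    (hY : ∀ n, StronglyMeasurable[ℱ (n + 1)] (Y n)) (hL : ∀ n, MemLp (Y n) 2 P)
    (hsum : Summable fun n => ∫ ω, Y n ω ^ 2 ∂P) :
    ∀ᵐ ω ∂P, ∃ c, Tendsto (fun n => ∑ k ∈ Finset.range n, (Y k ω - (P[Y k | ℱ k]) ω))
      atTop (𝓝 c) := by
  set D : ℕ → Ω → ℝ := fun k => Y k - P[Y k | ℱ k] with hD
  set M : ℕ → Ω → ℝ := fun n => ∑ k ∈ Finset.range n, D k with hM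
  have hDL : ∀ k, MemLp (D k) 2 P := fun k => (hL k).sub ((hL k).condExp (by norm_num))
  have hML : ∀ n, MemLp (M n) 2 P := fun n => memLp_finsetSum' _ fun k _ => hDL k
  have hDm : ∀ k, StronglyMeasurable[ℱ (k + 1)] (D k) := fun k =>
    (hY k).sub (stronglyMeasurable_condExp.mono (ℱ.mono k.le_succ))
  have hMm : ∀ n, StronglyMeasurable[ℱ n] (M n) := fun n =>
    Finset.stronglyMeasurable_sum _ fun k hk =>
      (hDm k).mono (ℱ.mono (Nat.succ_le_of_lt (Finset.mem_range.1 hk)))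
  have hMs : ∀ n, M (n + 1) = M n + D n := fun n => Finset.sum_range_succ _ _
  have hDc : ∀ k, P[D k | ℱ k] =ᵐ[P] 0 := by
    intro k
    have hi := (hL k).integrable (by norm_num)
    refine (condExp_sub hi integrable_condExp _).trans ?_
    rw [condExp_of_stronglyMeasurable (ℱ.le k) stronglyMeasurable_condExp integrable_condExp]
    simp
  have hmart : Martingale M ℱ P := by
    refine martingale_of_condExp_sub_eq_zero_nat hMm
      (fun n => (hML n).integrable (by norm_num)) fun n => ?_
    rw [hMs, add_sub_cancel_left]
    exact hDc n
  -- Conditional centring does not increase the second moment.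
  have hDsq : ∀ k, ∫ ω, D k ω ^ 2 ∂P ≤ ∫ ω, Y k ω ^ 2 ∂P := by
    intro k
    have h1 := condVar_ae_le_condExp_sq (ℱ.le k) (hL k)
    have h2 := integral_mono_ae integrable_condVar integrable_condExp h1
    rw [integral_condExp] at h2
    rw [condVar, integral_condExp] at h2
    exact h2
  have hMD : ∀ n, ∫ ω, M n ω * D n ω ∂P = 0 := by
    intro n
    have hi : Integrable (M n * D n) P := (hML n).integrable_mul (hDL n)
    have h1 := condExp_mul_of_stronglyMeasurable_left (hMm n) hi
      ((hDL n).integrable (by norm_num))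
    have h2 : ∫ ω, (M n * D n) ω ∂P = 0 := by
      rw [← integral_condExp (ℱ.le n), integral_congr_ae h1]
      rw [← integral_zero Ω ℝ (μ := P)]
      refine integral_congr_ae ?_
      filter_upwards [hDc n] with ω hω
      simp [hω]
    exact h2
  have hMsq : ∀ n, ∫ ω, M n ω ^ 2 ∂P ≤ ∑ k ∈ Finset.range n, ∫ ω, Y k ω ^ 2 ∂P := by
    intro n
    induction n with
    | zero => simp [hM]
    | succ n ih =>
      rw [Finset.sum_range_succ, hMs]
      have e : ∀ ω, (M n + D n) ω ^ 2 = M n ω ^ 2 + 2 * (M n ω * D n ω) + D n ω ^ 2 := by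
        intro ω; simp only [Pi.add_apply]; ring
      simp_rw [e]
      rw [integral_add _ (hDL n).integrable_sq, integral_add (hML n).integrable_sq,
        integral_const_mul, hMD]
      · linarith [hDsq n]
      · exact ((hML n).integrable_mul (hDL n)).const_mul 2
      · exact (hML n).integrable_sq.add (((hML n).integrable_mul (hDL n)).const_mul 2)
  have hbdd : ∀ n, eLpNorm (M n) 1 P ≤ ((1 + ∑' k, ∫ ω, Y k ω ^ 2 ∂P).toNNReal : ENNReal) := by
    intro n
    have hi := (hML n).integrable (by norm_num)
    rw [eLpNorm_one_eq_lintegral_enorm, ← ofReal_integral_norm_eq_lintegral_enorm hi]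
    refine ENNReal.ofReal_le_ofReal ?_
    have h1 : ∫ ω, ‖M n ω‖ ∂P ≤ ∫ ω, (1 + M n ω ^ 2) ∂P := by
      refine integral_mono hi.norm ((integrable_const _).add (hML n).integrable_sq) fun ω => ?_
      simp only [Real.norm_eq_abs]
      nlinarith [sq_abs (M n ω), sq_nonneg (|M n ω| - 1)]
    rw [integral_add (integrable_const _) (hML n).integrable_sq] at h1
    simp only [integral_const, probReal_univ, smul_eq_mul, mul_one] at h1
    linarith [hMsq n, hsum.sum_le_tsum (Finset.range n)
      (fun k _ => integral_nonneg fun ω => sq_nonneg (Y k ω))]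
  filter_upwards [hmart.submartingale.exists_ae_tendsto_of_bdd hbdd] with ω hω
  simpa [hM, hD] using hω

end Probability

/-! ### Uniform lower bound for the mean displacement. -/

section MeanOperator

theorem integral_norm_le_of_eLpNorm_one_le {α F : Type*} [MeasurableSpace α] {μ : Measure α}
    [NormedAddCommGroup F] {f : α → F} (hf : Integrable f μ) {c : ℝ} (hc : 0 ≤ c)
    (h : eLpNorm f 1 μ ≤ ENNReal.ofReal c) : ∫ s, ‖f s‖ ∂μ ≤ c := by
  rwa [eLpNorm_one_eq_lintegral_enorm, ← ofReal_integral_norm_eq_lintegral_enorm hf,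
    ENNReal.ofReal_le_ofReal_iff hc] at h

variable {E H : Type*} [MeasurableSpace E] [NormedAddCommGroup H] [InnerProductSpace ℝ H]
  [CompleteSpace H] [TopologicalSpace.SeparableSpace H] [MeasurableSpace H] [BorelSpace H]

/-- On bounded subsets of the common domain, the averaged displacement of the resolvents of small
parameter is asymptotically monotone with respect to the graph of the mean operator. -/
theorem exists_forall_inner_le_integral_inner_sub_resolventMap (μ : Measure E)
    [IsProbabilityMeasure μ] (A : E → H → Set H) (hA_max : ∀ᵐ s ∂μ, IsMaximalMonotoneOp (A s))
    (hA_meas : ∀ r : ℝ, 0 < r → ∀ x : H, Measurable fun s => resolventMap (A s) r x)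
    {K : Set H} (hK : Bornology.IsBounded K)
    (hA0 : UniformIntegrable
      (fun (x : ↥(K ∩ essDomain μ A)) (s : E) => ‖leastNorm (A s x)‖) 1 μ)
    {u v : H} (hv : v ∈ meanOp μ A u) {ε : ℝ} (hε : 0 < ε) :
    ∃ δ > 0, ∀ r, 0 < r → r < δ → ∀ x ∈ K ∩ essDomain μ A,
      r * (inner ℝ v (x - u) - ε) ≤ ∫ s, inner ℝ (x - resolventMap (A s) r x) (x - u) ∂μ := by
  obtain ⟨ψ, ⟨hψm, hψA, hψL⟩, rfl⟩ := hv
  obtain ⟨C, hC⟩ : ∃ C > 0, ∀ x ∈ K, ‖x - u‖ ≤ C := by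
    obtain ⟨C, hC⟩ := hK.exists_norm_le
    refine ⟨max (C + ‖u‖) 1, by positivity, fun x hx => ?_⟩
    exact ((norm_sub_le x u).trans (by linarith [hC x hx])).trans (le_max_left _ _)
  obtain ⟨hC0, hC⟩ := hC
  have hψi : Integrable ψ μ := memLp_one_iff_integrable.1 hψL
  obtain ⟨-, hUI, B, hB⟩ := id hA0
  have hη : 0 < ε / (4 * C) := by positivity
  obtain ⟨δ₁, hδ₁, h₁⟩ := hUI hη
  obtain ⟨δ₂, hδ₂, h₂⟩ := hψL.eLpNorm_indicator_le le_rfl ENNReal.one_ne_top hη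
  set δ := min δ₁ δ₂ with hδ
  have hδ0 : 0 < δ := lt_min hδ₁ hδ₂
  -- By Markov's inequality `‖ψ‖ ≥ M` has measure at most `δ`, whatever `x` and `r` are.
  set M := (∫ s, ‖ψ s‖ ∂μ) / δ + 1 with hM
  have hI0 : 0 ≤ ∫ s, ‖ψ s‖ ∂μ := integral_nonneg fun s => norm_nonneg _
  have hM0 : 0 < M := by positivity
  set t := {s | M ≤ ‖ψ s‖} with ht
  have htm : MeasurableSet t := measurableSet_le measurable_const hψm.norm
  have hμt : μ t ≤ ENNReal.ofReal δ := by
    have h := mul_meas_ge_le_integral_of_nonneg (ae_of_all μ fun s => norm_nonneg (ψ s)) hψi.norm M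
    have h' : ∫ s, ‖ψ s‖ ∂μ ≤ M * δ := by
      rw [hM, add_mul, div_mul_cancel₀ _ hδ0.ne']; linarith
    rw [← ofReal_measureReal (measure_ne_top μ t)]
    exact ENNReal.ofReal_le_ofReal (le_of_mul_le_mul_left (h.trans h') hM0)
  have hψt : ∫ s, t.indicator (fun s => ‖ψ s‖) s ∂μ ≤ ε / (4 * C) := by
    have := integral_norm_le_of_eLpNorm_one_le (hψi.indicator htm) hη.le
      (h₂ t htm (hμt.trans (ENNReal.ofReal_le_ofReal (min_le_right _ _))))
    simpa only [norm_indicator_eq_indicator_norm] using this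
  refine ⟨ε / (2 * (M * B + 1)), by positivity, fun r hr hrδ x hx => ?_⟩
  have haL := hA0.memLp ⟨x, hx⟩
  set a : E → ℝ := fun s => ‖leastNorm (A s x)‖ with ha
  have hai : Integrable a μ := memLp_one_iff_integrable.1 haL
  have hat : ∫ s, t.indicator a s ∂μ ≤ ε / (4 * C) := by
    have := integral_norm_le_of_eLpNorm_one_le (hai.indicator htm) hη.le
      (h₁ ⟨x, hx⟩ t htm (hμt.trans (ENNReal.ofReal_le_ofReal (min_le_left _ _))))
    simpa only [norm_indicator_eq_indicator_norm, ha, norm_norm] using this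
  have haB : ∫ s, a s ∂μ ≤ B := by
    have := integral_norm_le_of_eLpNorm_one_le hai B.coe_nonneg
      (by rw [ENNReal.ofReal_coe_nnreal]; exact hB ⟨x, hx⟩)
    simpa only [ha, norm_norm] using this
  have hstep : ∀ᵐ s ∂μ, ‖x - resolventMap (A s) r x‖ ≤ r * a s := by
    filter_upwards [hA_max, hx.2] with s hs hxs
    exact hs.norm_sub_resolventMap_le hr (hs.leastNorm_mem hxs)
  have hJi : Integrable (fun s => (inner ℝ (x - resolventMap (A s) r x) (x - u) : ℝ)) μ := by
    refine ((hai.const_mul r).mul_const C).mono' ?_ ?_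
    · exact ((measurable_const.sub (hA_meas r hr x)).inner_const).aestronglyMeasurable
    · filter_upwards [hstep] with s hs
      exact (norm_inner_le_norm _ _).trans
        (mul_le_mul hs (hC x hx.1) (norm_nonneg _) (by positivity))
  -- Where `‖ψ‖ ≥ M`, Cauchy–Schwarz suffices since the set is small. Elsewhere monotonicity is used
  -- at the resolvent, and moving back to `x` costs at most `r² M a(s)`. After integration each
  -- error is at most `r ε / 2`.
  have hpt : ∀ᵐ s ∂μ, r * inner ℝ (ψ s) (x - u) - r * (r * M * a s
      + C * (t.indicator a s + t.indicator (fun s => ‖ψ s‖) s)) ≤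
      inner ℝ (x - resolventMap (A s) r x) (x - u) := by
    filter_upwards [hA_max, hψA, hstep] with s hs hψs hxs
    have ha0 : 0 ≤ a s := norm_nonneg _
    have hCx := hC x hx.1
    by_cases hst : s ∈ t
    · rw [Set.indicator_of_mem hst, Set.indicator_of_mem hst]
      have e1 : -(r * a s * C) ≤ inner ℝ (x - resolventMap (A s) r x) (x - u) := by
        have := abs_le.1 ((abs_real_inner_le_norm (x - resolventMap (A s) r x) (x - u)).trans
          (mul_le_mul hxs hCx (norm_nonneg _) (by positivity)))
        exact this.1
      have e2 : inner ℝ (ψ s) (x - u) ≤ ‖ψ s‖ * C :=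
        (real_inner_le_norm _ _).trans (mul_le_mul_of_nonneg_left hCx (norm_nonneg _))
      have e3 := mul_le_mul_of_nonneg_left e2 hr.le
      have e4 : 0 ≤ r * (r * M * a s) := by positivity
      linarith
    · rw [Set.indicator_of_notMem hst, Set.indicator_of_notMem hst]
      have e1 := hs.inner_resolventMap hr x hψs
      set y := resolventMap (A s) r x
      have hψM : ‖ψ s‖ ≤ M := (not_le.1 hst).le
      have e2 : inner ℝ (x - y) (x - u) = inner ℝ (x - y) (y - u) + ‖x - y‖ ^ 2 := by
        rw [← real_inner_self_eq_norm_sq, ← inner_add_right]; congr 1; abel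
      have e3 : inner ℝ (ψ s) (y - u) = inner ℝ (ψ s) (x - u) - inner ℝ (ψ s) (x - y) := by
        rw [← inner_sub_right]; congr 1; abel
      have e4 : inner ℝ (ψ s) (x - y) ≤ M * (r * a s) :=
        (real_inner_le_norm _ _).trans (mul_le_mul hψM hxs (norm_nonneg _) hM0.le)
      have e5 := mul_le_mul_of_nonneg_left e4 hr.le
      rw [e3] at e1
      rw [e2]
      nlinarith [sq_nonneg ‖x - y‖]
  have hi1 : Integrable (fun s => (inner ℝ (ψ s) (x - u) : ℝ)) μ := hψi.inner_const _
  have hi2 : Integrable (fun s => t.indicator a s + t.indicator (fun s => ‖ψ s‖) s) μ :=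
    (hai.indicator htm).add (hψi.norm.indicator htm)
  have hi3 : Integrable (fun s => r * M * a s
      + C * (t.indicator a s + t.indicator (fun s => ‖ψ s‖) s)) μ :=
    (hai.const_mul _).add (hi2.const_mul _)
  have hmain := integral_mono_ae ((hi1.const_mul r).sub (hi3.const_mul r)) hJi hpt
  refine le_trans ?_ hmain
  rw [integral_sub' (hi1.const_mul r) (hi3.const_mul r), integral_const_mul, integral_const_mul,
    integral_add (hai.const_mul _) (hi2.const_mul _), integral_const_mul, integral_const_mul,
    integral_add (hai.indicator htm) (hψi.norm.indicator htm)]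
  have hin : ∫ s, (inner ℝ (ψ s) (x - u) : ℝ) ∂μ = inner ℝ (∫ s, ψ s ∂μ) (x - u) := by
    simp_rw [real_inner_comm (x - u)]
    exact integral_inner hψi _
  rw [hin, ← mul_sub]
  refine mul_le_mul_of_nonneg_left ?_ hr.le
  have f1 : r * M * ∫ s, a s ∂μ ≤ ε / 2 := by
    have : r * M * ∫ s, a s ∂μ ≤ r * M * B := mul_le_mul_of_nonneg_left haB (by positivity)
    rw [lt_div_iff₀ (by positivity)] at hrδ
    linarith
  have f2 : C * (∫ s, t.indicator a s ∂μ + ∫ s, t.indicator (fun s => ‖ψ s‖) s ∂μ) ≤ ε / 2 := by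
    have : C * (∫ s, t.indicator a s ∂μ + ∫ s, t.indicator (fun s => ‖ψ s‖) s ∂μ) ≤
        C * (ε / (4 * C) + ε / (4 * C)) :=
      mul_le_mul_of_nonneg_left (add_le_add hat hψt) hC0.le
    have e : C * (ε / (4 * C) + ε / (4 * C)) = ε / 2 := by field_simp; ring
    linarith
  linarith

end MeanOperator

/-! ### Weighted averages and weak convergence. -/

section Ergodic

variable {H : Type*} [NormedAddCommGroup H] [InnerProductSpace ℝ H]

theorem sum_Icc_one_eq_sum_range {G : Type*} [AddCommMonoid G] (f : ℕ → G) (n : ℕ) :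
    ∑ k ∈ Finset.Icc 1 n, f k = ∑ i ∈ Finset.range n, f (i + 1) := by
  rw [Finset.range_eq_Ico, Finset.sum_Ico_add']
  rfl

theorem weightedAverage_eq_sum_range {F : Type*} [NormedAddCommGroup F] [InnerProductSpace ℝ F]
    (r : ℕ → ℝ) (a : ℕ → F) (n : ℕ) :
    weightedAverage r a n =
      (∑ i ∈ Finset.range n, r (i + 1))⁻¹ • ∑ i ∈ Finset.range n, r (i + 1) • a (i + 1) := by
  rw [weightedAverage, sum_Icc_one_eq_sum_range, sum_Icc_one_eq_sum_range]

theorem tendsto_sum_range_succ_atTop {r : ℕ → ℝ} (hr_pos : ∀ n, 0 < r n) (hr_sum : ¬ Summable r) :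
    Tendsto (fun n => ∑ i ∈ Finset.range n, r (i + 1)) atTop atTop :=
  (not_summable_iff_tendsto_nat_atTop_of_nonneg fun n => (hr_pos _).le).1
    (by rwa [summable_nat_add_iff 1])

/-- The weighted averages of a convergent real sequence converge. -/
theorem tendsto_weightedAverage {r : ℕ → ℝ} (hr_pos : ∀ n, 0 < r n) (hr_sum : ¬ Summable r)
    {a : ℕ → ℝ} {l : ℝ} (ha : Tendsto a atTop (𝓝 l)) :
    Tendsto (weightedAverage r a) atTop (𝓝 l) := by
  have hS := tendsto_sum_range_succ_atTop hr_pos hr_sum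
  have h1 : (fun i => r (i + 1) * (a (i + 1) - l)) =o[atTop] fun i => r (i + 1) := by
    have h : (fun i => a (i + 1) - l) =o[atTop] fun _ => (1 : ℝ) := by
      rw [Asymptotics.isLittleO_one_iff]
      simpa using ((tendsto_add_atTop_iff_nat 1).2 ha).sub_const l
    simpa using (Asymptotics.isBigO_refl (fun i => r (i + 1)) atTop).mul_isLittleO h
  have h2 := (h1.sum_range (fun i => (hr_pos _).le) hS).tendsto_div_nhds_zero
  have h3 := h2.add_const l
  rw [zero_add] at h3
  refine h3.congr' ?_
  filter_upwards [hS.eventually_gt_atTop 0] with n hn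
  rw [weightedAverage_eq_sum_range]
  simp only [smul_eq_mul, mul_sub, Finset.sum_sub_distrib, ← Finset.sum_mul]
  field_simp
  ring

theorem inner_weightedAverage (r : ℕ → ℝ) (x : ℕ → H) (w : H) (n : ℕ) :
    inner ℝ w (weightedAverage r x n) = weightedAverage r (fun k => (inner ℝ w (x k) : ℝ)) n := by
  simp only [weightedAverage, inner_smul_right, inner_sum, smul_eq_mul]

theorem norm_weightedAverage_le {r : ℕ → ℝ} (hr_pos : ∀ n, 0 < r n) {x : ℕ → H} {R : ℝ}
    (hx : ∀ n, ‖x n‖ ≤ R) (n : ℕ) : ‖weightedAverage r x n‖ ≤ R := by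
  have hR : 0 ≤ R := (norm_nonneg _).trans (hx 0)
  rw [weightedAverage, norm_smul, norm_inv, Real.norm_of_nonneg
    (Finset.sum_nonneg fun k _ => (hr_pos k).le)]
  have h : ‖∑ k ∈ Finset.Icc 1 n, r k • x k‖ ≤ (∑ k ∈ Finset.Icc 1 n, r k) * R := by
    rw [Finset.sum_mul]
    refine norm_sum_le_of_le _ fun k _ => ?_
    rw [norm_smul, Real.norm_of_nonneg (hr_pos k).le]
    exact mul_le_mul_of_nonneg_left (hx k) (hr_pos k).le
  rcases (Finset.sum_nonneg fun k _ => (hr_pos k).le :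
    0 ≤ ∑ k ∈ Finset.Icc 1 n, r k).eq_or_lt with h0 | h0
  · rw [← h0]; simpa using hR
  · rw [inv_mul_le_iff₀ h0]; exact h

theorem exists_norm_le_of_tendsto_norm_sub_sq {F : Type*} [SeminormedAddCommGroup F] {x : ℕ → F}
    {z : F} {c : ℝ} (h : Tendsto (fun n => ‖x n - z‖ ^ 2) atTop (𝓝 c)) :
    ∃ R, ∀ n, ‖x n‖ ≤ R := by
  obtain ⟨b, hb⟩ := h.bddAbove_range
  refine ⟨b + 1 + ‖z‖, fun n => ?_⟩
  have h1 : ‖x n - z‖ ^ 2 ≤ b := hb ⟨n, rfl⟩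
  have h2 : ‖x n‖ ≤ ‖x n - z‖ + ‖z‖ := by simpa using norm_add_le (x n - z) z
  nlinarith [sq_nonneg (‖x n - z‖ - 1)]

theorem continuous_inner_toWeakSpace_symm (w : H) :
    Continuous fun p : WeakSpace ℝ H => (inner ℝ w ((toWeakSpace ℝ H).symm p) : ℝ) :=
  WeakBilin.eval_continuous (topDualPairing ℝ H).flip (innerSL ℝ w)

variable [CompleteSpace H]

/-- Bounded subsets of a Hilbert space are relatively weakly compact. -/
theorem isCompact_closure_toWeakSpace_image_closedBall (R : ℝ) :
    IsCompact (closure (toWeakSpace ℝ H '' Metric.closedBall 0 R)) := by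
  refine NormedSpace.isCompact_closure_of_isBounded ℝ H _ ?_ ?_
  · rw [Set.preimage_image_eq _ (toWeakSpace ℝ H).injective]
    exact Metric.isBounded_closedBall
  · rintro Φ -
    let Φ' : StrongDual ℝ (StrongDual ℝ H) := WeakDual.toStrongDual Φ
    -- Reflexivity by the Riesz theorem, applied to `H` and then to its dual.
    let L : H →ₗ[ℝ] ℝ :=
      { toFun := fun y => Φ' (innerSL ℝ y)
        map_add' := fun y y' => by simp
        map_smul' := fun c y => by simp }
    let L' : StrongDual ℝ H := L.mkContinuous ‖Φ'‖ fun y => by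
      refine (Φ'.le_opNorm _).trans ?_
      rw [innerSL_apply_norm]
    refine ⟨toWeakSpace ℝ H ((InnerProductSpace.toDual ℝ H).symm L'), ?_⟩
    refine DFunLike.ext _ _ fun f => ?_
    have h1 : f = innerSL ℝ ((InnerProductSpace.toDual ℝ H).symm f) := by
      ext y
      simp [InnerProductSpace.toDual_symm_apply]
    have h2 : f ((InnerProductSpace.toDual ℝ H).symm L') = Φ' f := by
      rw [← InnerProductSpace.toDual_symm_apply, real_inner_comm,
        InnerProductSpace.toDual_symm_apply]
      conv_rhs => rw [h1]
      rfl
    exact h2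

/-- **Ergodic weak convergence**: an Opial-type criterion for the weighted averages. -/
theorem exists_tendsto_toWeakSpace_weightedAverage {T : H → Set H} (hT : IsMaximalMonotoneOp T)
    {r : ℕ → ℝ} (hr_pos : ∀ n, 0 < r n) (hr_sum : ¬ Summable r) {x : ℕ → H}
    {Z : Set H} (hZne : Z.Nonempty) (hZ : opZeros T ⊆ closure Z)
    (hfejer : ∀ z ∈ Z, ∃ c, Tendsto (fun n => ‖x n - z‖ ^ 2) atTop (𝓝 c))
    {Q : Set (H × H)} (hQ : {p : H × H | p.2 ∈ T p.1} ⊆ closure Q)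
    (hmono : ∀ p ∈ Q, ∀ ε > 0, ∃ B, ∀ n,
      ∑ i ∈ Finset.range n, r (i + 1) * (inner ℝ p.2 (x (i + 1) - p.1) - ε) ≤ B) :
    ∃ z ∈ opZeros T, Tendsto (fun n => toWeakSpace ℝ H (weightedAverage r x n)) atTop
      (𝓝 (toWeakSpace ℝ H z)) := by
  obtain ⟨R, hR⟩ : ∃ R, ∀ n, ‖x n‖ ≤ R := by
    obtain ⟨z, hz⟩ := hZne
    obtain ⟨c, hc⟩ := hfejer z hz
    exact exists_norm_le_of_tendsto_norm_sub_sq hc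
  have hS := tendsto_sum_range_succ_atTop hr_pos hr_sum
  set y : ℕ → WeakSpace ℝ H := fun n => toWeakSpace ℝ H (weightedAverage r x n) with hy
  set K := closure (toWeakSpace ℝ H '' Metric.closedBall 0 R)
  have hK : IsCompact K := isCompact_closure_toWeakSpace_image_closedBall R
  have hmem : ∀ n, y n ∈ K := fun n => subset_closure
    ⟨_, by simpa using norm_weightedAverage_le hr_pos hR n, rfl⟩
  have hclu : ∀ p, MapClusterPt p atTop y → (toWeakSpace ℝ H).symm p ∈ opZeros T := by
    intro p hp
    set z := (toWeakSpace ℝ H).symm p with hz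
    have hQz : ∀ q ∈ Q, inner ℝ q.2 (z - q.1) ≤ 0 := by
      intro q hq
      have hcont := (continuous_inner_toWeakSpace_symm q.2)
      have hcl := hp.continuousAt_comp hcont.continuousAt
      rw [inner_sub_right, sub_nonpos]
      refine le_of_forall_pos_le_add fun ε hε => ?_
      by_contra hlt
      push Not at hlt
      -- A gap `ε` in the average leaves `ε / 2` times the total weight, which exceeds `B` once that
      -- weight passes `2 B / ε`.
      obtain ⟨B, hB⟩ := hmono q hq (ε / 2) (half_pos hε)
      have hfr := hcl.frequently (lt_mem_nhds hlt)
      obtain ⟨n, hn1, hn2⟩ := (hfr.and_eventually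
        (hS.eventually_gt_atTop (max 0 (2 * B / ε)))).exists
      have hpos : 0 < ∑ i ∈ Finset.range n, r (i + 1) := (le_max_left _ _).trans_lt hn2
      have hbig := (le_max_right _ _).trans_lt hn2
      rw [div_lt_iff₀ hε] at hbig
      simp only [hy, Function.comp, LinearEquiv.symm_apply_apply] at hn1
      rw [inner_weightedAverage, weightedAverage_eq_sum_range, smul_eq_mul,
        ← div_eq_inv_mul, lt_div_iff₀ hpos] at hn1
      have := hB n
      simp only [inner_sub_right, smul_eq_mul, mul_sub, Finset.sum_sub_distrib,
        ← Finset.sum_mul] at this hn1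
      nlinarith
    refine hT.mem_of_forall fun u v hv => ?_
    have hclosed : IsClosed {q : H × H | inner ℝ q.2 (z - q.1) ≤ 0} :=
      isClosed_le (by fun_prop) continuous_const
    have := closure_minimal (fun q hq => hQz q hq) hclosed (hQ (a := (u, v)) hv)
    change inner ℝ v (z - u) ≤ 0 at this
    rw [zero_sub, inner_neg_left]
    linarith
  -- By polarization `⟪z - z', x_n⟫` converges for `z`, `z'` in `Z`, so its averages do too and `a -
  -- a'` is orthogonal to `z - z'`. By density this extends to all zeroes, in particular to `a` and
  -- `a'` themselves.
  have huniq : ∀ p p', MapClusterPt p atTop y → MapClusterPt p' atTop y → p = p' := by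
    intro p p' hp hp'
    set a := (toWeakSpace ℝ H).symm p with ha
    set a' := (toWeakSpace ℝ H).symm p' with ha'
    have hlim : ∀ z ∈ Z, ∀ z' ∈ Z, inner ℝ (z - z') (a - a') = 0 := by
      intro z hz z' hz'
      obtain ⟨c, hc⟩ := hfejer z hz
      obtain ⟨c', hc'⟩ := hfejer z' hz'
      have h1 : Tendsto (fun n => (inner ℝ (z - z') (x n) : ℝ)) atTop
          (𝓝 ((c' - c + (‖z‖ ^ 2 - ‖z'‖ ^ 2)) / 2)) := by
        refine (((hc'.sub hc).add_const _).div_const 2).congr fun n => ?_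
        rw [norm_sub_sq_real, norm_sub_sq_real, inner_sub_left, real_inner_comm z,
          real_inner_comm z']
        ring
      have h2 := tendsto_weightedAverage hr_pos hr_sum h1
      have hval : ∀ q, MapClusterPt q atTop y →
          inner ℝ (z - z') ((toWeakSpace ℝ H).symm q) =
            (c' - c + (‖z‖ ^ 2 - ‖z'‖ ^ 2)) / 2 := by
        intro q hq
        have hcl := hq.continuousAt_comp
          (continuous_inner_toWeakSpace_symm (z - z')).continuousAt
        have hT' : Tendsto ((fun q => (inner ℝ (z - z') ((toWeakSpace ℝ H).symm q) : ℝ)) ∘ y) atTop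
            (𝓝 ((c' - c + (‖z‖ ^ 2 - ‖z'‖ ^ 2)) / 2)) := by
          refine h2.congr fun n => ?_
          simp only [hy, Function.comp, LinearEquiv.symm_apply_apply, inner_weightedAverage]
        exact @eq_of_nhds_neBot _ _ _ _ _ (hcl.clusterPt.neBot.mono (inf_le_inf_left _ hT'))
      rw [inner_sub_right, hval p hp, hval p' hp', sub_self]
    have hext : ∀ z ∈ opZeros T, ∀ z' ∈ opZeros T, inner ℝ (z - z') (a - a') = 0 := by
      intro z hz z' hz'
      have hclosed : IsClosed {q : H × H | inner ℝ (q.1 - q.2) (a - a') = 0} :=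
        isClosed_eq (by fun_prop) continuous_const
      have hin : (z, z') ∈ closure (Z ×ˢ Z) := by
        rw [closure_prod_eq]; exact ⟨hZ hz, hZ hz'⟩
      exact closure_minimal (fun q hq => hlim _ hq.1 _ hq.2) hclosed hin
    have := hext a (hclu p hp) a' (hclu p' hp')
    rw [inner_self_eq_zero, sub_eq_zero] at this
    exact (toWeakSpace ℝ H).symm.injective this
  obtain ⟨p, -, hp⟩ := hK.exists_mapClusterPt_of_frequently (l := atTop) (f := y)
    (Frequently.of_forall hmem)
  refine ⟨(toWeakSpace ℝ H).symm p, hclu p hp, ?_⟩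
  rw [LinearEquiv.apply_symm_apply]
  exact hK.tendsto_nhds_of_unique_mapClusterPt (Eventually.of_forall hmem)
    fun q _ hq => huniq q p hq hp

end Ergodic

/-! ### Almost sure summability and real sequences. -/

section Auxiliary

/-- A series of non-negative functions with summable integrals converges almost everywhere. -/
theorem ae_summable_of_summable_integral {α : Type*} [MeasurableSpace α] {μ : Measure α}
    {f : ℕ → α → ℝ} (hf0 : ∀ n a, 0 ≤ f n a) (hf : ∀ n, Integrable (f n) μ)
    (hsum : Summable fun n => ∫ a, f n a ∂μ) : ∀ᵐ a ∂μ, Summable fun n => f n a := by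
  have h1 : ∫⁻ a, ∑' n, ENNReal.ofReal (f n a) ∂μ ≠ ⊤ := by
    rw [lintegral_tsum fun n => (hf n).aestronglyMeasurable.aemeasurable.ennreal_ofReal]
    simp_rw [← ofReal_integral_eq_lintegral_ofReal (hf _) (ae_of_all _ (hf0 _))]
    rw [← ENNReal.ofReal_tsum_of_nonneg (fun n => integral_nonneg (hf0 n)) hsum]
    exact ENNReal.ofReal_ne_top
  have hm : AEMeasurable (fun a => ∑' n, ENNReal.ofReal (f n a)) μ :=
    AEMeasurable.tsum fun n => (hf n).aestronglyMeasurable.aemeasurable.ennreal_ofReal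
  filter_upwards [ae_lt_top' hm h1] with a ha
  exact (ENNReal.summable_toReal ha.ne).congr fun n => by rw [ENNReal.toReal_ofReal (hf0 n a)]

/-- A non-negative sequence that decreases up to convergent perturbations converges. -/
theorem exists_tendsto_of_succ_le_add_sub {V Y W : ℕ → ℝ} (hV : ∀ n, 0 ≤ V n)
    (h : ∀ n, V (n + 1) ≤ V n - Y n + W n)
    (hY : ∃ c, Tendsto (fun n => ∑ k ∈ Finset.range n, Y k) atTop (𝓝 c)) (hW : Summable W) :
    ∃ c, Tendsto V atTop (𝓝 c) := by
  obtain ⟨c, hc⟩ := hY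
  have hW' := hW.hasSum.tendsto_sum_nat
  have hanti : Antitone fun n =>
      V n + ∑ k ∈ Finset.range n, Y k - ∑ k ∈ Finset.range n, W k := by
    refine antitone_nat_of_succ_le fun n => ?_
    simp only [Finset.sum_range_succ]
    linarith [h n]
  obtain ⟨b, hb⟩ := (hc.sub hW').bddBelow_range
  have hlim := tendsto_atTop_ciInf hanti ⟨b, by
    rintro _ ⟨n, rfl⟩
    have := hb ⟨n, rfl⟩
    simp only at this
    linarith [hV n]⟩
  refine ⟨_, ((hlim.sub hc).add hW').congr fun n => ?_⟩
  ring

/-- The finitely many indices violating `a k ≤ b k` cost only a constant. The shift matches averages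
that start at index one. -/
theorem exists_sum_range_succ_le {a b : ℕ → ℝ} {B : ℝ}
    (hb : ∀ n, ∑ k ∈ Finset.range n, b k ≤ B) (hab : ∀ᶠ k in atTop, a k ≤ b k) :
    ∃ B', ∀ n, ∑ k ∈ Finset.range n, a (k + 1) ≤ B' := by
  obtain ⟨N, hN⟩ := eventually_atTop.1 hab
  have hs : Summable fun k => max (a k - b k) 0 :=
    summable_of_ne_finset_zero (s := Finset.range N) fun k hk =>
      max_eq_right (by linarith [hN k (by simpa using hk)])
  refine ⟨B + ∑' k, max (a k - b k) 0 - a 0, fun n => ?_⟩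
  have h1 := Finset.sum_range_succ' a n
  have h2 : ∑ k ∈ Finset.range (n + 1), a k ≤
      ∑ k ∈ Finset.range (n + 1), b k + ∑ k ∈ Finset.range (n + 1), max (a k - b k) 0 := by
    rw [← Finset.sum_add_distrib]
    exact Finset.sum_le_sum fun k _ => by linarith [le_max_left (a k - b k) 0]
  linarith [hb (n + 1), hs.sum_le_tsum (Finset.range (n + 1)) fun k _ => le_max_right _ _]

end Auxiliary

/-! ### Stochastic estimates along the iteration. -/

section Iteration

variable {E H Ω : Type*} [MeasurableSpace E] [NormedAddCommGroup H] [InnerProductSpace ℝ H]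
  [SecondCountableTopology H] [MeasurableSpace H] [BorelSpace H]
  {mΩ : MeasurableSpace Ω}

/-- Square-integrable Fejér monotonicity: an adapted sequence satisfying the basic estimate of the
proximal point algorithm has square-summable increments in `L²`, and its distance to the reference
point converges almost surely. -/
theorem summable_integral_increments_and_ae_tendsto [CompleteSpace H] {P : Measure Ω} [IsProbabilityMeasure P]
    {μ : Measure E} [IsProbabilityMeasure μ] (ℱ : Filtration ℕ mΩ) {η : ℕ → Ω → E}
    (hη : ∀ n, Measurable[ℱ (n + 1)] (η n)) (hlaw : ∀ n, P.map (η n) = μ)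
    (hind : ∀ n, Indep (ℱ n) (MeasurableSpace.comap (η n) inferInstance) P)
    {X : ℕ → Ω → H} (hX : ∀ n, Measurable[ℱ n] (X n)) {x₀ : H} (hX0 : ∀ ω, X 0 ω = x₀)
    {r : ℕ → ℝ} (hr_sq : Summable fun n => r n ^ 2) {z : H} {φ : E → H} (hφm : Measurable φ)
    (hφL : MemLp φ 2 μ) (hφ0 : ∫ s, φ s ∂μ = 0)
    (hstep : ∀ n, ∀ᵐ ω ∂P, ‖X (n + 1) ω - z‖ ^ 2 ≤ ‖X n ω - z‖ ^ 2
      - ‖X (n + 1) ω - X n ω‖ ^ 2 / 2 - 2 * (r n * inner ℝ (φ (η n ω)) (X n ω - z))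
      + 2 * (r n ^ 2 * ‖φ (η n ω)‖ ^ 2)) :
    (∀ n, Integrable (fun ω => ‖X (n + 1) ω - X n ω‖ ^ 2) P) ∧
    (Summable fun n => ∫ ω, ‖X (n + 1) ω - X n ω‖ ^ 2 ∂P) ∧
    ∀ᵐ ω ∂P, ∃ c, Tendsto (fun n => ‖X n ω - z‖ ^ 2) atTop (𝓝 c) := by
  have hη' : ∀ n, Measurable (η n) := fun n => (hη n).mono (ℱ.le _) le_rfl
  have hX' : ∀ n, Measurable (X n) := fun n => (hX n).mono (ℱ.le _) le_rfl
  have hφsq : Integrable (fun s => ‖φ s‖ ^ 2) μ := hφL.integrable_norm_pow (by norm_num)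
  have hφint : Integrable φ μ := hφL.integrable (by norm_num)
  set C := ∫ s, ‖φ s‖ ^ 2 ∂μ with hC
  have hC0 : 0 ≤ C := integral_nonneg fun s => sq_nonneg _
  have hφη : ∀ n, Integrable (fun ω => ‖φ (η n ω)‖ ^ 2) P := fun n => by
    rw [← hlaw n] at hφsq
    exact hφsq.comp_measurable (hη' n)
  have hφηC : ∀ n, ∫ ω, ‖φ (η n ω)‖ ^ 2 ∂P = C := fun n => by
    rw [hC, ← hlaw n, integral_map (hη' n).aemeasurable
      (hφm.norm.pow_const 2).aestronglyMeasurable]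
  set V : ℕ → Ω → ℝ := fun n ω => ‖X n ω - z‖ ^ 2 with hV
  set Y : ℕ → Ω → ℝ := fun n ω => r n * inner ℝ (φ (η n ω)) (X n ω - z) with hY
  have hVm : ∀ n, Measurable (V n) := fun n => ((hX' n).sub_const z).norm.pow_const 2
  have hYm : ∀ n, Measurable[ℱ (n + 1)] (Y n) := fun n =>
    ((hφm.comp (hη n)).inner (((hX n).mono (ℱ.mono n.le_succ) le_rfl).sub_const z)).const_mul (r n)
  have hYm' : ∀ n, Measurable (Y n) := fun n => (hYm n).mono (ℱ.le _) le_rfl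
  have hYabs : ∀ n ω, |Y n ω| ≤ |r n| * (‖φ (η n ω)‖ * ‖X n ω - z‖) := fun n ω => by
    rw [hY, abs_mul]
    exact mul_le_mul_of_nonneg_left (abs_real_inner_le_norm _ _) (abs_nonneg _)
  have hVi : ∀ n, Integrable (V n) P := by
    intro n
    induction n with
    | zero => simp only [hV, hX0]; exact integrable_const _
    | succ n ih =>
      -- The factors 2 and 3 come from `2 |r| ‖φ‖ ‖X - z‖ ≤ r² ‖φ‖² + ‖X - z‖²`.
      refine ((ih.const_mul 2).add ((hφη n).const_mul (3 * r n ^ 2))).mono'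
        (hVm _).aestronglyMeasurable ?_
      filter_upwards [hstep n] with ω hω
      have h1 := hYabs n ω
      rw [Real.norm_of_nonneg (sq_nonneg _)]
      have h2 := neg_le_of_abs_le h1
      simp only [hV, hY, Pi.add_apply] at h2 ⊢
      nlinarith [sq_nonneg (|r n| * ‖φ (η n ω)‖ - ‖X n ω - z‖), sq_abs (r n),
        sq_nonneg ‖X (n + 1) ω - X n ω‖]
  have hΔm : ∀ n, Measurable fun ω => ‖X (n + 1) ω - X n ω‖ ^ 2 := fun n =>
    ((hX' (n + 1)).sub (hX' n)).norm.pow_const 2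
  have hΔi : ∀ n, Integrable (fun ω => ‖X (n + 1) ω - X n ω‖ ^ 2) P := by
    intro n
    refine (((hVi (n + 1)).const_mul 2).add ((hVi n).const_mul 2)).mono'
      (hΔm n).aestronglyMeasurable (ae_of_all _ fun ω => ?_)
    rw [Real.norm_of_nonneg (sq_nonneg _)]
    have h1 := norm_sub_le (X (n + 1) ω - z) (X n ω - z)
    rw [sub_sub_sub_cancel_right] at h1
    simp only [hV, Pi.add_apply]
    nlinarith [sq_nonneg (‖X (n + 1) ω - z‖ - ‖X n ω - z‖), norm_nonneg (X (n + 1) ω - X n ω)]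
  -- Independence of `X n` and `η n` factors the expectation, so `Y n` is square integrable although
  -- `φ` is only in `L²`.
  have hprod : ∀ n, Integrable (fun ω => ‖φ (η n ω)‖ ^ 2 * V n ω) P ∧
      ∫ ω, ‖φ (η n ω)‖ ^ 2 * V n ω ∂P = C * ∫ ω, V n ω ∂P := by
    intro n
    have hi0 : IndepFun (X n) (η n) P := indep_of_indep_of_le_left (hind n) (hX n).comap_le
    have hi : IndepFun (fun ω => ‖φ (η n ω)‖ ^ 2) (V n) P :=
      hi0.symm.comp (hφm.norm.pow_const 2) ((measurable_id.sub_const z).norm.pow_const 2)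
    refine ⟨hi.integrable_mul (hφη n) (hVi n), ?_⟩
    rw [← hφηC n]
    exact hi.integral_fun_mul_eq_mul_integral (hφη n).aestronglyMeasurable
      (hVi n).aestronglyMeasurable
  have hYsq : ∀ n ω, Y n ω ^ 2 ≤ r n ^ 2 * (‖φ (η n ω)‖ ^ 2 * V n ω) := fun n ω => by
    rw [← sq_abs]
    calc |Y n ω| ^ 2 ≤ (|r n| * (‖φ (η n ω)‖ * ‖X n ω - z‖)) ^ 2 :=
          pow_le_pow_left₀ (abs_nonneg _) (hYabs n ω) 2
      _ = _ := by rw [mul_pow, mul_pow, sq_abs]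
  have hYL : ∀ n, MemLp (Y n) 2 P := fun n =>
    (memLp_two_iff_integrable_sq (hYm' n).aestronglyMeasurable).2
      (((hprod n).1.const_mul (r n ^ 2)).mono' ((hYm' n).pow_const 2).aestronglyMeasurable
        (ae_of_all _ fun ω => by
          rw [Real.norm_of_nonneg (sq_nonneg _)]; exact hYsq n ω))
  have hYi : ∀ n, Integrable (Y n) P := fun n => (hYL n).integrable (by norm_num)
  have hYc : ∀ n, P[Y n | ℱ n] =ᵐ[P] 0 := by
    intro n
    have hg : Measurable (Function.uncurry fun (s : E) (x : H) =>
        (r n * inner ℝ (φ s) (x - z) : ℝ)) :=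
      ((hφm.comp measurable_fst).inner (measurable_snd.sub_const z)).const_mul (r n)
    have h := condExp_comp_of_indep (ℱ.le n) (hη' n) (hlaw n) (hind n) (hX n) hg (hYi n)
    refine h.trans (ae_of_all _ fun ω => ?_)
    simp only [Pi.zero_apply]
    rw [integral_const_mul]
    simp_rw [real_inner_comm (X n ω - z)]
    rw [integral_inner hφint, hφ0, inner_zero_right, mul_zero]
  have hY0 : ∀ n, ∫ ω, Y n ω ∂P = 0 := fun n => by
    rw [← integral_condExp (ℱ.le n), integral_congr_ae (hYc n)]
    simp
  have hrec : ∀ n, ∫ ω, V (n + 1) ω ∂P + (∫ ω, ‖X (n + 1) ω - X n ω‖ ^ 2 ∂P) / 2 ≤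
      ∫ ω, V n ω ∂P + 2 * (r n ^ 2 * C) := by
    intro n
    have hi1 := (hVi n).sub ((hΔi n).div_const 2)
    have hi2 := hi1.sub ((hYi n).const_mul 2)
    have hi3 := ((hφη n).const_mul (r n ^ 2)).const_mul 2
    have h := integral_mono_ae (hVi (n + 1)) (hi2.add hi3) (hstep n)
    rw [integral_add' hi2 hi3, integral_sub' hi1 ((hYi n).const_mul 2),
      integral_sub' (hVi n) ((hΔi n).div_const 2), integral_div, integral_const_mul,
      integral_const_mul, integral_const_mul, integral_const_mul, hφηC] at h
    have h0 := hY0 n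
    rw [integral_const_mul] at h0
    rw [h0] at h
    linarith
  have hbound : ∀ n, ∫ ω, V n ω ∂P +
      (∑ k ∈ Finset.range n, ∫ ω, ‖X (k + 1) ω - X k ω‖ ^ 2 ∂P) / 2 ≤
      ‖x₀ - z‖ ^ 2 + 2 * C * ∑ k ∈ Finset.range n, r k ^ 2 := by
    intro n
    induction n with
    | zero => simp [hV, hX0]
    | succ n ih =>
      rw [Finset.sum_range_succ, Finset.sum_range_succ]
      linarith [hrec n]
  set B := ‖x₀ - z‖ ^ 2 + 2 * C * ∑' k, r k ^ 2 with hB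
  have hboundB : ∀ n, ∫ ω, V n ω ∂P +
      (∑ k ∈ Finset.range n, ∫ ω, ‖X (k + 1) ω - X k ω‖ ^ 2 ∂P) / 2 ≤ B := fun n =>
    (hbound n).trans (by
      have := hr_sq.sum_le_tsum (Finset.range n) fun k _ => sq_nonneg (r k)
      rw [hB]; gcongr)
  have hV0 : ∀ n, 0 ≤ ∫ ω, V n ω ∂P := fun n => integral_nonneg fun ω => sq_nonneg _
  have hΔ0 : ∀ n, 0 ≤ ∫ ω, ‖X (n + 1) ω - X n ω‖ ^ 2 ∂P := fun n =>
    integral_nonneg fun ω => sq_nonneg _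
  have hΔs : Summable fun n => ∫ ω, ‖X (n + 1) ω - X n ω‖ ^ 2 ∂P :=
    summable_of_sum_range_le (c := 2 * B) hΔ0 fun n => by linarith [hboundB n, hV0 n]
  refine ⟨hΔi, hΔs, ?_⟩
  have hYs : Summable fun n => ∫ ω, Y n ω ^ 2 ∂P := by
    refine Summable.of_nonneg_of_le (fun n => integral_nonneg fun ω => sq_nonneg _) (fun n => ?_)
      (hr_sq.mul_right (C * B))
    have h1 : ∫ ω, Y n ω ^ 2 ∂P ≤ ∫ ω, r n ^ 2 * (‖φ (η n ω)‖ ^ 2 * V n ω) ∂P :=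
      integral_mono (hYL n).integrable_sq ((hprod n).1.const_mul _) (hYsq n)
    rw [integral_const_mul, (hprod n).2] at h1
    refine h1.trans ?_
    have h2 : ∫ ω, V n ω ∂P ≤ B := by
      linarith [hboundB n, Finset.sum_nonneg fun k (_ : k ∈ Finset.range n) => hΔ0 k]
    gcongr
  have hW : ∀ᵐ ω ∂P, Summable fun n => r n ^ 2 * ‖φ (η n ω)‖ ^ 2 := by
    refine ae_summable_of_summable_integral (fun n ω => by positivity)
      (fun n => (hφη n).const_mul _) ?_
    simp_rw [integral_const_mul, hφηC]
    exact hr_sq.mul_right C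
  filter_upwards [ae_exists_tendsto_sum_sub_condExp ℱ Y (fun n => (hYm n).stronglyMeasurable)
    hYL hYs, hW, ae_all_iff.2 hYc, ae_all_iff.2 hstep] with ω h1 h2 h3 h4
  obtain ⟨c, hc⟩ := h1
  simp only [h3, Pi.zero_apply, sub_zero] at hc
  refine exists_tendsto_of_succ_le_add_sub (Y := fun n => 2 * Y n ω)
    (W := fun n => 2 * (r n ^ 2 * ‖φ (η n ω)‖ ^ 2)) (fun n => sq_nonneg _) (fun n => ?_)
    ⟨2 * c, ?_⟩ (h2.mul_left 2)
  · have := h4 n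
    simp only [hY]
    linarith [sq_nonneg ‖X (n + 1) ω - X n ω‖]
  · simp_rw [← Finset.mul_sum]
    exact hc.const_mul 2

/-- Along bounded paths, the accumulated mean displacements, measured in the direction of a fixed
point, are bounded above. -/
theorem ae_exists_sum_integral_inner_le {P : Measure Ω} [IsProbabilityMeasure P]
    {μ : Measure E} (ℱ : Filtration ℕ mΩ) {η : ℕ → Ω → E}
    (hη : ∀ n, Measurable[ℱ (n + 1)] (η n)) (hlaw : ∀ n, P.map (η n) = μ)
    (hind : ∀ n, Indep (ℱ n) (MeasurableSpace.comap (η n) inferInstance) P)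
    {X : ℕ → Ω → H} (hX : ∀ n, Measurable[ℱ n] (X n)) {J : ℕ → E → H → H}
    (hJ : ∀ n, Measurable (Function.uncurry (J n)))
    (hXJ : ∀ n ω, X (n + 1) ω = J n (η n ω) (X n ω))
    (hΔi : ∀ n, Integrable (fun ω => ‖X (n + 1) ω - X n ω‖ ^ 2) P)
    (hΔs : Summable fun n => ∫ ω, ‖X (n + 1) ω - X n ω‖ ^ 2 ∂P) (u : H) :
    ∀ᵐ ω ∂P, (∃ R : ℝ, ∀ n, ‖X n ω‖ ≤ R) → ∃ B, ∀ n,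
      ∑ k ∈ Finset.range n, ∫ s, inner ℝ (X k ω - J k s (X k ω)) (X k ω - u) ∂μ ≤ B := by
  have hη' : ∀ n, Measurable (η n) := fun n => (hη n).mono (ℱ.le _) le_rfl
  have hX' : ∀ n, Measurable (X n) := fun n => (hX n).mono (ℱ.le _) le_rfl
  have hΔω : ∀ᵐ ω ∂P, Summable fun n => ‖X (n + 1) ω - X n ω‖ ^ 2 :=
    ae_summable_of_summable_integral (fun n ω => sq_nonneg _) hΔi hΔs
  -- Truncation to a ball gives square-summable terms and is inactive on paths that stay inside.
  -- Countably many radii cover all bounded paths.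
  have key : ∀ R : ℕ, ∀ᵐ ω ∂P, (∀ n, ‖X n ω‖ ≤ R) → ∃ c, Tendsto (fun n =>
      ∑ k ∈ Finset.range n, (inner ℝ (X k ω - X (k + 1) ω) (X k ω - u)
        - ∫ s, inner ℝ (X k ω - J k s (X k ω)) (X k ω - u) ∂μ)) atTop (𝓝 c) := by
    intro R
    set g : ℕ → E → H → ℝ := fun n s x =>
      (Metric.closedBall (0 : H) R).indicator (fun x => inner ℝ (x - J n s x) (x - u)) x with hg
    have hgm : ∀ n, Measurable (Function.uncurry (g n)) := by
      intro n
      have h1 : Measurable fun p : E × H => (inner ℝ (p.2 - J n p.1 p.2) (p.2 - u) : ℝ) :=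
        (measurable_snd.sub (hJ n)).inner (measurable_snd.sub_const u)
      exact h1.indicator (measurable_snd Metric.isClosed_closedBall.measurableSet)
    set Y : ℕ → Ω → ℝ := fun n ω => g n (η n ω) (X n ω) with hY
    have hYm : ∀ n, Measurable[ℱ (n + 1)] (Y n) := fun n =>
      (hgm n).comp ((hη n).prodMk ((hX n).mono (ℱ.mono n.le_succ) le_rfl))
    have hYm' : ∀ n, Measurable (Y n) := fun n => (hYm n).mono (ℱ.le _) le_rfl
    have hYb : ∀ n ω, Y n ω ^ 2 ≤ (R + ‖u‖) ^ 2 * ‖X (n + 1) ω - X n ω‖ ^ 2 := by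
      intro n ω
      simp only [hY, hg]
      by_cases h : X n ω ∈ Metric.closedBall (0 : H) R
      · rw [Set.indicator_of_mem h, ← hXJ, ← sq_abs, ← mul_pow]
        refine pow_le_pow_left₀ (abs_nonneg _) ((abs_real_inner_le_norm _ _).trans ?_) 2
        rw [norm_sub_rev (X n ω) (X (n + 1) ω), mul_comm]
        refine mul_le_mul_of_nonneg_right ((norm_sub_le _ _).trans ?_) (norm_nonneg _)
        have : ‖X n ω‖ ≤ R := by simpa using h
        gcongr
      · rw [Set.indicator_of_notMem h, zero_pow two_ne_zero]
        positivity
    have hYL : ∀ n, MemLp (Y n) 2 P := fun n =>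
      (memLp_two_iff_integrable_sq (hYm' n).aestronglyMeasurable).2
        (((hΔi n).const_mul _).mono' ((hYm' n).pow_const 2).aestronglyMeasurable
          (ae_of_all _ fun ω => by
            rw [Real.norm_of_nonneg (sq_nonneg _)]; exact hYb n ω))
    have hYs : Summable fun n => ∫ ω, Y n ω ^ 2 ∂P := by
      refine Summable.of_nonneg_of_le (fun n => integral_nonneg fun ω => sq_nonneg _) (fun n => ?_)
        (hΔs.mul_left ((R + ‖u‖) ^ 2))
      rw [← integral_const_mul]
      exact integral_mono (hYL n).integrable_sq ((hΔi n).const_mul _) (hYb n)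
    have hYc : ∀ n, P[Y n | ℱ n] =ᵐ[P] fun ω => ∫ s, g n s (X n ω) ∂μ := fun n =>
      condExp_comp_of_indep (ℱ.le n) (hη' n) (hlaw n) (hind n) (hX n) (hgm n)
        ((hYL n).integrable (by norm_num))
    filter_upwards [ae_exists_tendsto_sum_sub_condExp ℱ Y (fun n => (hYm n).stronglyMeasurable)
      hYL hYs, ae_all_iff.2 hYc] with ω h1 h2 hR
    obtain ⟨c, hc⟩ := h1
    refine ⟨c, hc.congr fun n => Finset.sum_congr rfl fun k _ => ?_⟩
    have hmem : X k ω ∈ Metric.closedBall (0 : H) R := by simpa using hR k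
    rw [h2 k]
    simp only [hY, hg, Set.indicator_of_mem hmem, ← hXJ]
  filter_upwards [hΔω, ae_all_iff.2 key] with ω h1 h2
  rintro ⟨R, hR⟩
  obtain ⟨R', hR'⟩ := exists_nat_ge R
  obtain ⟨c, hc⟩ := h2 R' fun n => (hR n).trans hR'
  obtain ⟨b, hb⟩ := hc.bddBelow_range
  refine ⟨(‖X 0 ω - u‖ ^ 2 + ∑' k, ‖X (k + 1) ω - X k ω‖ ^ 2) / 2 - b, fun n => ?_⟩
  have hbn := hb ⟨n, rfl⟩
  simp only [Finset.sum_sub_distrib] at hbn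
  -- Telescoping of the expansion of `‖X (k + 1) ω - u‖²`.
  have hid : ∀ n, ∑ k ∈ Finset.range n, (inner ℝ (X k ω - X (k + 1) ω) (X k ω - u) : ℝ) =
      (‖X 0 ω - u‖ ^ 2 - ‖X n ω - u‖ ^ 2
        + ∑ k ∈ Finset.range n, ‖X (k + 1) ω - X k ω‖ ^ 2) / 2 := by
    intro n
    induction n with
    | zero => simp
    | succ n ih =>
      rw [Finset.sum_range_succ, Finset.sum_range_succ, ih]
      have e : X (n + 1) ω - u = (X n ω - u) - (X n ω - X (n + 1) ω) := by abel
      rw [e, norm_sub_sq_real (X n ω - u), norm_sub_rev (X (n + 1) ω) (X n ω),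
        real_inner_comm (X n ω - X (n + 1) ω)]
      ring
  rw [hid] at hbn
  linarith [h1.sum_le_tsum (Finset.range n) fun k _ => sq_nonneg ‖X (k + 1) ω - X k ω‖,
    sq_nonneg ‖X n ω - u‖]

end Iteration

/-! ### The filtration of the strict past. -/

section Filtration

variable {E Ω : Type*} [MeasurableSpace E] {mΩ : MeasurableSpace Ω} {η : ℕ → Ω → E}

/-- The filtration generated by the strict past of a sequence of random variables. -/
def pastFiltration (η : ℕ → Ω → E) (hη : ∀ n, Measurable (η n)) : Filtration ℕ mΩ where
  seq n := ⨆ k ∈ Set.Iio n, MeasurableSpace.comap (η k) inferInstance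
  mono' _ _ h := biSup_mono fun _ hk => lt_of_lt_of_le hk h
  le' _ := iSup₂_le fun k _ => (hη k).comap_le

theorem measurable_pastFiltration_succ (hη : ∀ n, Measurable (η n)) (n : ℕ) :
    Measurable[pastFiltration η hη (n + 1)] (η n) :=
  measurable_iff_comap_le.2
    (le_biSup (fun k => MeasurableSpace.comap (η k) inferInstance) (Set.mem_Iio.2 n.lt_succ_self))

theorem indep_pastFiltration {P : Measure Ω} (hη : ∀ n, Measurable (η n)) (hind : iIndepFun η P)
    (n : ℕ) : Indep (pastFiltration η hη n) (MeasurableSpace.comap (η n) inferInstance) P := by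
  have h := indep_iSup_of_disjoint (fun k => (hη k).comap_le) hind
    (S := Set.Iio n) (T := {n}) (by simp)
  simp only [Set.mem_singleton_iff, iSup_iSup_eq_left] at h
  exact h

end Filtration

end StochProx

/-! ### Assembly of the convergence theorem. -/

theorem mainTheorem3
    {E : Type*} [MeasurableSpace E] (μ : Measure E) [IsProbabilityMeasure μ] [μ.IsComplete]
    {H : Type*} [NormedAddCommGroup H] [InnerProductSpace ℝ H] [CompleteSpace H]
    [TopologicalSpace.SeparableSpace H] [MeasurableSpace H] [BorelSpace H]
    {Ω : Type*} [MeasurableSpace Ω] (P : Measure Ω) [IsProbabilityMeasure P]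
    (A : E → H → Set H)
    -- almost every `A s` is maximal monotone, and the resolvents are measurable in `s`
    (hA_max : ∀ᵐ s ∂μ, IsMaximalMonotoneOp (A s))
    (hA_meas : ∀ r : ℝ, 0 < r → ∀ x : H, Measurable fun s => resolventMap (A s) r x)
    -- the step sizes are positive and belong to `ℓ² \ ℓ¹`
    (r : ℕ → ℝ) (hr_pos : ∀ n, 0 < r n)
    (hr_sq : Summable fun n => r n ^ 2) (hr_sum : ¬ Summable r)
    -- the random variables `ξ₁, ξ₂, …` are independent with distribution `μ`
    (ξ : ℕ+ → Ω → E) (hξ_meas : ∀ n, Measurable (ξ n)) (hξ_indep : iIndepFun ξ P)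
    (hξ_law : ∀ n, P.map (ξ n) = μ)
    -- the mean operator is maximal monotone
    (hmean : IsMaximalMonotoneOp (meanOp μ A))
    -- the mean operator has a zero, and all its zeroes have square integrable representations
    (hzer : (opZeros (meanOp μ A)).Nonempty)
    (hzer_two : opZeros (meanOp μ A) ⊆ pZeros μ A 2)
    -- the least-norm selections are uniformly integrable over bounded sets
    (hA0 : ∀ K : Set H, Bornology.IsBounded K →
      UniformIntegrable (fun (x : ↥(K ∩ essDomain μ A)) (s : E) => ‖leastNorm (A s x)‖) 1 μ)
    -- the domains coincide almost everywhere
    (hdom : ∃ S : Set H, ∀ᵐ s ∂μ, opDomain (A s) = S)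
    (x₀ : H) :
    ∀ᵐ ω ∂P, ∃ z ∈ opZeros (meanOp μ A),
      Tendsto
        (fun n => toWeakSpace ℝ H (weightedAverage r (fun k => proxIter A r ξ x₀ k ω) n))
        atTop (𝓝 (toWeakSpace ℝ H z)) := by
  have : SecondCountableTopology H := UniformSpace.secondCountable_of_separable H
  obtain ⟨S, hS⟩ := hdom
  -- a measurable null set off which the operators are maximal monotone with common domain
  obtain ⟨N, hNsub, hNm, hN0⟩ := exists_measurable_superset_of_null (ae_iff.1 (hA_max.and hS))
  have hN : ∀ s, s ∉ N → IsMaximalMonotoneOp (A s) ∧ opDomain (A s) = S := fun s hs => by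
    by_contra h
    exact hs (hNsub h)
  have hNae : ∀ᵐ s ∂μ, s ∉ N := measure_eq_zero_iff_ae_notMem.1 hN0
  classical
  -- The identity on the null set `N` makes `J n s` continuous for every `s`; with measurability in
  -- `s` this gives joint measurability.
  let J : ℕ → E → H → H := fun n s x => if s ∈ N then x else resolventMap (A s) (r n) x
  have hJN : ∀ n s x, s ∉ N → J n s x = resolventMap (A s) (r n) x := fun n s x hs => if_neg hs
  have hJm : ∀ n, Measurable (Function.uncurry (J n)) := by
    intro n
    have h : Measurable (Function.uncurry fun x s => J n s x) := by
      refine measurable_uncurry_of_continuous_of_measurable (fun s => ?_) fun x =>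
        Measurable.ite hNm measurable_const (hA_meas _ (hr_pos n) x)
      by_cases hs : s ∈ N
      · simpa only [J, if_pos hs] using continuous_id'
      · simp only [J, if_neg hs]
        exact (LipschitzWith.of_dist_le_mul (K := 1) fun x y => by
          simpa [dist_eq_norm] using
            (hN s hs).1.norm_resolventMap_sub_le (hr_pos n) x y).continuous
    exact h.comp measurable_swap
  let η : ℕ → Ω → E := fun n => ξ n.succPNat
  have hηm : ∀ n, Measurable (η n) := fun n => hξ_meas _
  have hηlaw : ∀ n, P.map (η n) = μ := fun n => hξ_law _
  have hηind : iIndepFun η P := hξ_indep.precomp Nat.succPNat_injective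
  have hηN : ∀ᵐ ω ∂P, ∀ n, η n ω ∉ N := ae_all_iff.2 fun n =>
    ae_of_ae_map (hηm n).aemeasurable (by rw [hηlaw n]; exact hNae)
  let ℱ := pastFiltration η hηm
  have hηℱ : ∀ n, Measurable[ℱ (n + 1)] (η n) := measurable_pastFiltration_succ hηm
  have hind : ∀ n, Indep (ℱ n) (MeasurableSpace.comap (η n) inferInstance) P :=
    indep_pastFiltration hηm hηind
  let X : ℕ → Ω → H := fun n ω => Nat.rec x₀ (fun k x => J k (η k ω) x) n
  have hX0 : ∀ ω, X 0 ω = x₀ := fun ω => rfl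
  have hXJ : ∀ n ω, X (n + 1) ω = J n (η n ω) (X n ω) := fun n ω => rfl
  have hXm : ∀ n, Measurable[ℱ n] (X n) := by
    intro n
    induction n with
    | zero => exact measurable_const
    | succ n ih => exact (hJm n).comp ((hηℱ n).prodMk (ih.mono (ℱ.mono n.le_succ) le_rfl))
  have hXprox : ∀ ω, (∀ n, η n ω ∉ N) → ∀ n, proxIter A r ξ x₀ n ω = X n ω := by
    intro ω hω n
    induction n with
    | zero => rfl
    | succ n ih => rw [hXJ, hJN _ _ _ (hω n), ← ih]; rfl
  -- The iterate lies in the domain of the operator just drawn, which is the common domain. The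
  -- starting point `x₀` may lie outside it, whence the index `n + 1`.
  have hXdom : ∀ ω, (∀ n, η n ω ∉ N) → ∀ n, X (n + 1) ω ∈ essDomain μ A := by
    intro ω hω n
    have h := (hN _ (hω n)).1.resolventMap_mem (hr_pos n) (X n ω)
    rw [← hJN _ _ _ (hω n), ← hXJ, (hN _ (hω n)).2] at h
    filter_upwards [hS] with s hs
    rwa [hs]
  have hstage : ∀ z ∈ opZeros (meanOp μ A),
      (∀ n, Integrable (fun ω => ‖X (n + 1) ω - X n ω‖ ^ 2) P) ∧
      (Summable fun n => ∫ ω, ‖X (n + 1) ω - X n ω‖ ^ 2 ∂P) ∧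
      ∀ᵐ ω ∂P, ∃ c, Tendsto (fun n => ‖X n ω - z‖ ^ 2) atTop (𝓝 c) := by
    intro z hz
    obtain ⟨φ, ⟨hφm, hφA, hφL⟩, hφ0⟩ := hzer_two hz
    refine summable_integral_increments_and_ae_tendsto ℱ hηℱ hηlaw hind hXm hX0 hr_sq hφm hφL hφ0
      fun n => ?_
    have hφη : ∀ᵐ ω ∂P, φ (η n ω) ∈ A (η n ω) z :=
      ae_of_ae_map (hηm n).aemeasurable (by rw [hηlaw n]; exact hφA)
    filter_upwards [hφη, hηN] with ω h1 h2
    rw [hXJ, hJN _ _ _ (h2 n)]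
    exact (hN _ (h2 n)).1.norm_resolventMap_sub_sq_le (hr_pos n) (X n ω) h1
  obtain ⟨z₀, hz₀⟩ := hzer
  obtain ⟨hΔi, hΔs, -⟩ := hstage z₀ hz₀
  -- Countable dense sets of zeroes and of graph points allow a single almost sure event to serve
  -- for all of them.
  obtain ⟨Z, hZsub, hZc, hZd⟩ := (TopologicalSpace.IsSeparable.of_separableSpace
    (opZeros (meanOp μ A))).exists_countable_dense_subset
  obtain ⟨Q, hQsub, hQc, hQd⟩ := (TopologicalSpace.IsSeparable.of_separableSpace
    {p : H × H | p.2 ∈ meanOp μ A p.1}).exists_countable_dense_subset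
  have hZne : Z.Nonempty := closure_nonempty_iff.1 ⟨z₀, hZd hz₀⟩
  filter_upwards [hηN, (ae_ball_iff hZc).2 fun z hz => (hstage z (hZsub hz)).2.2,
    (ae_ball_iff hQc).2 fun q _ => ae_exists_sum_integral_inner_le ℱ hηℱ hηlaw hind hXm hJm hXJ
      hΔi hΔs q.1] with ω h1 h2 h3
  simp only [hXprox ω h1]
  refine exists_tendsto_toWeakSpace_weightedAverage hmean hr_pos hr_sum hZne hZd h2 hQd ?_
  intro q hq ε hε
  obtain ⟨R, hR⟩ : ∃ R, ∀ n, ‖X n ω‖ ≤ R := by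
    obtain ⟨z, hz⟩ := hZne
    obtain ⟨c, hc⟩ := h2 z hz
    exact exists_norm_le_of_tendsto_norm_sub_sq hc
  obtain ⟨B, hB⟩ := h3 q hq ⟨R, hR⟩
  refine exists_sum_range_succ_le (a := fun k => r k * (inner ℝ q.2 (X k ω - q.1) - ε)) hB ?_
  have hK : Bornology.IsBounded (Metric.closedBall (0 : H) R) := Metric.isBounded_closedBall
  obtain ⟨δ, hδ, hδr⟩ := exists_forall_inner_le_integral_inner_sub_resolventMap μ A hA_max hA_meas
    hK (hA0 _ hK) (hQsub hq) hε
  have hr0 : Tendsto r atTop (𝓝 0) := by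
    have := (hr_sq.tendsto_atTop_zero).sqrt
    simpa only [Real.sqrt_sq (hr_pos _).le, Real.sqrt_zero] using this
  filter_upwards [hr0.eventually_lt_const hδ, eventually_ge_atTop 1] with k hk hk1
  obtain ⟨m, rfl⟩ := Nat.exists_eq_add_of_le' hk1
  refine (hδr _ (hr_pos _) hk (X (m + 1) ω) ⟨by simpa using hR (m + 1), hXdom ω h1 m⟩).trans_eq ?_
  refine integral_congr_ae ?_
  filter_upwards [hNae] with s hs
  rw [hJN _ _ _ hs]
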